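/- **Notation.** For $n\ge 1$ let $\mathbf W_n=S_n\wr\mathbb Z_2$ be the group of signed $n\times n$ permutation matrices, acting on $\mathfrak{so}(n,\mathbb R)$ by conjugation $\Omega\mapsto w\Omega w^{-1}$. Given a set $K$ of unitary matrices and a map $U\mapsto H_U$ from $K$ to real $n\times n$ matrices, the *operator lift* is the control system $$\dot R(t)=-H_{U(t)}R(t)\qquad\text{on } \mathrm{SO}(n).\tag{L}$$ A solution on $[0,T]$ is an absolutely continuous path $R:[0,T]\to \mathrm{SO}(n)$ satisfying (L) almost everywhere for some measurable $U:[0,T]\to K$. The system is *controllable* if for all $R_1,R_2\in \mathrm{SO}(n)$ there are $T\ge0$ and a solution on $[0,T]$ with $R(0)=R_1$ and $R(T)=R_2$. **Proposition.** 1. (Distinguishable subsystems.) Let $d_1,d_2\ge2$ and $d_{\min}=\min(d_1,d_2)$. Then $\mathbf W_{d_{\min}}$ acts irreducibly on $\mathfrak{so}(d_{\min},\mathbb R)$. Let $H_0$ be a Hermitian operator on $\mathbb C^{d_1}\otimes\mathbb C^{d_2}$ which is not local, i.e. not of the form $E\otimes 1+1\otimes F$ with $E,F$ Hermitian. Let $K=\{V\otimes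 W: V\in \mathrm U(d_1), W\in \mathrm U(d_2)\}$ and $H_U=\Pi\circ U^*(\mathrm i H_0)U\circ\operatorname{diag}$, where $\operatorname{diag}(\sigma)=\sum_{i=1}^{d_{\min}}\sigma_i|i\rangle\otimes|i\rangle$ for $\sigma\in\mathbb R^{d_{\min}}$ and $\Pi|\psi\rangle=(\mathrm{Re}\langle ii|\psi\rangle)_{i=1}^{d_{\min}}$. Then (L) on $\mathrm{SO}(d_{\min})$ is controllable. 2. (Bosonic case.) Let $d\ge2$. Then $\mathbf W_d$ acts irreducibly on $\mathfrak{so}(d,\mathbb R)$. Let $H_0$ be a Hermitian operator on $\mathbb C^d\otimes\mathbb C^d$ which commutes with the swap of the two tensor factors and whose action on $\mathrm{Sym}^2(\mathbb C^d)$ is not local, i.e. there is no Hermitian $E$ with $H_0\psi=(E\otimes1+1\otimes E)\psi$ for all $\psi\in\mathrm{Sym}^2(\mathbb C^d)$. Let $K=\{V\otimes V:V\in \mathrm U(d)\}$ and let $H_U$ be given by the formula of part 1 with $d_1=d_2=d$. Then (L) on $\mathrm{SO}(d)$ is controllable. 3. (Fermionic case.) Let $d\ge2$ and $n=\lfloor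 d/2\rfloor$. If $d\ge4$, then $\mathbf W_n$ acts irreducibly on $\mathfrak{so}(n,\mathbb R)$ (for $d=2,3$ one has $\mathfrak{so}(n,\mathbb R)=0$). Let $H_0$ be a Hermitian operator on $\mathbb C^d\otimes\mathbb C^d$ which commutes with the swap and whose action on $\bigwedge^2(\mathbb C^d)$ is not local, i.e. there is no Hermitian $E$ with $H_0\psi=(E\otimes1+1\otimes E)\psi$ for all $\psi\in\bigwedge^2(\mathbb C^d)$. Let $K=\{V\otimes V:V\in \mathrm U(d)\}$ and $H_U=\Pi\circ U^*(\mathrm i H_0)U\circ\operatorname{qdiag}$, where $\operatorname{qdiag}(\xi)=\tfrac1{\sqrt2}\sum_{i=1}^{n}\xi_i(|2i-1\rangle\otimes|2i\rangle-|2i\rangle\otimes|2i-1\rangle)$ for $\xi\in\mathbb R^n$ and $\Pi|\psi\rangle=(\sqrt2\,\mathrm{Re}\langle 2i-1,2i|\psi\rangle)_{i=1}^{n}$. Then (L) on $\mathrm{SO}(n)$ is controllable. -/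

import Mathlib

open Matrix MeasureTheory
open scoped Kronecker

noncomputable section

namespace Bipartite

/-! ### The group of signed permutations and its conjugation action on `so(n, ℝ)` -/

/-- The generalized (signed) permutation matrix with `e_j ↦ ε_j e_{π(j)}`. -/
def signedPermMatrix {n : ℕ} (π : Equiv.Perm (Fin n)) (ε : Fin n → ℤˣ) :
    Matrix (Fin n) (Fin n) ℝ :=
  Matrix.of fun i j => if i = π j then ((ε j : ℤ) : ℝ) else 0

theorem signedPermMatrix_mul {n : ℕ} (π ρ : Equiv.Perm (Fin n)) (ε δ : Fin n → ℤˣ) :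
    signedPermMatrix π ε * signedPermMatrix ρ δ
      = signedPermMatrix (π * ρ) (fun j => ε (ρ j) * δ j) := by
  ext i j
  simp [signedPermMatrix, Matrix.mul_apply]

theorem signedPermMatrix_one {n : ℕ} :
    signedPermMatrix (1 : Equiv.Perm (Fin n)) (fun _ => 1) = 1 := by
  ext i j
  simp [signedPermMatrix, Matrix.one_apply]

theorem signedPermMatrix_transpose {n : ℕ} (π : Equiv.Perm (Fin n)) (ε : Fin n → ℤˣ) :
    (signedPermMatrix π ε)ᵀ = signedPermMatrix π⁻¹ (fun j => ε (π⁻¹ j)) := by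
  ext i j
  simp only [signedPermMatrix, Matrix.transpose_apply, Matrix.of_apply]
  by_cases h : j = π i
  · subst h
    simp
  · have h' : ¬ i = π⁻¹ j := fun e => h (by simp [e])
    rw [if_neg h, if_neg h']

theorem signedPermMatrix_mul_transpose {n : ℕ} (π : Equiv.Perm (Fin n)) (ε : Fin n → ℤˣ) :
    signedPermMatrix π ε * (signedPermMatrix π ε)ᵀ = 1 := by
  rw [signedPermMatrix_transpose, signedPermMatrix_mul, ← signedPermMatrix_one]
  congr 1
  · simp
  · funext j
    exact Int.units_mul_self _

/-- The Weyl group `S_n ≀ ℤ/2`, realized as the group of signed permutation matrices. -/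
def weylGroup (n : ℕ) : Subgroup (GL (Fin n) ℝ) where
  carrier := {w | ∃ (π : Equiv.Perm (Fin n)) (ε : Fin n → ℤˣ),
    (w : Matrix (Fin n) (Fin n) ℝ) = signedPermMatrix π ε}
  one_mem' := ⟨1, fun _ => 1, by rw [signedPermMatrix_one]; rfl⟩
  mul_mem' := by
    rintro a b ⟨π, ε, ha⟩ ⟨ρ, δ, hb⟩
    exact ⟨π * ρ, fun j => ε (ρ j) * δ j, by
      rw [Units.val_mul, ha, hb, signedPermMatrix_mul]⟩
  inv_mem' := by
    rintro a ⟨π, ε, ha⟩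
    refine ⟨π⁻¹, fun j => ε (π⁻¹ j), ?_⟩
    rw [← signedPermMatrix_transpose, ← ha]
    refine Units.inv_eq_of_mul_eq_one_right ?_
    rw [ha, signedPermMatrix_mul_transpose]

theorem weylGroup_inv {n : ℕ} (w : weylGroup n) :
    (((w : GL (Fin n) ℝ)⁻¹ : GL (Fin n) ℝ) : Matrix (Fin n) (Fin n) ℝ)
      = ((w : GL (Fin n) ℝ) : Matrix (Fin n) (Fin n) ℝ)ᵀ := by
  obtain ⟨w, π, ε, hw⟩ := w
  refine Units.inv_eq_of_mul_eq_one_right ?_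
  rw [hw, signedPermMatrix_mul_transpose]

/-- The action of the Weyl group on `so(n, ℝ)` by conjugation, `Ω ↦ w Ω w⁻¹`. -/
def weylRep (n : ℕ) : Representation ℝ (weylGroup n) (LieAlgebra.Orthogonal.so (Fin n) ℝ) where
  toFun w :=
    { toFun := fun Ω => ⟨((w : GL (Fin n) ℝ) : Matrix (Fin n) (Fin n) ℝ) * Ω.1 *
          (((w : GL (Fin n) ℝ)⁻¹ : GL (Fin n) ℝ) : Matrix (Fin n) (Fin n) ℝ), by
        have h := (LieAlgebra.Orthogonal.mem_so (Fin n) ℝ Ω.1).1 Ω.2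
        rw [LieAlgebra.Orthogonal.mem_so, weylGroup_inv, Matrix.transpose_mul,
          Matrix.transpose_mul, Matrix.transpose_transpose, h]
        simp [Matrix.mul_assoc]⟩
      map_add' := fun Ω Ω' => Subtype.ext (by simp [Matrix.mul_add, Matrix.add_mul])
      map_smul' := fun c Ω => Subtype.ext (by simp) }
  map_one' := by
    ext Ω : 2
    simp
  map_mul' w w' := by
    ext Ω : 2
    simp [Matrix.mul_assoc]

/-! ### States, Hamiltonians and local unitaries

Vectors of `ℂ^{d₁} ⊗ ℂ^{d₂}` are functions `Fin d₁ × Fin d₂ → ℂ`, with `|i⟩ ⊗ |j⟩` the standard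
basis vector at `(i, j)`; the tensor product of matrices is the Kronecker product. -/

/-- The basis vector `|i⟩ ⊗ |j⟩`. -/
def ket {d₁ d₂ : ℕ} (i : Fin d₁) (j : Fin d₂) : Fin d₁ × Fin d₂ → ℂ := Pi.single (i, j) 1

/-- `U_loc(d₁, d₂) = {V ⊗ W : V ∈ U(d₁), W ∈ U(d₂)}`. -/
def localUnitaries (d₁ d₂ : ℕ) : Set (Matrix (Fin d₁ × Fin d₂) (Fin d₁ × Fin d₂) ℂ) :=
  {U | ∃ V ∈ unitaryGroup (Fin d₁) ℂ, ∃ W ∈ unitaryGroup (Fin d₂) ℂ, U = V ⊗ₖ W}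

/-- `U_loc^s(d) = {V ⊗ V : V ∈ U(d)}`. -/
def symLocalUnitaries (d : ℕ) : Set (Matrix (Fin d × Fin d) (Fin d × Fin d) ℂ) :=
  {U | ∃ V ∈ unitaryGroup (Fin d) ℂ, U = V ⊗ₖ V}

/-- A Hamiltonian is local if it equals `E ⊗ 1 + 1 ⊗ F` with `E` and `F` Hermitian. -/
def IsLocal {d₁ d₂ : ℕ} (H₀ : Matrix (Fin d₁ × Fin d₂) (Fin d₁ × Fin d₂) ℂ) : Prop :=
  ∃ (E : Matrix (Fin d₁) (Fin d₁) ℂ) (F : Matrix (Fin d₂) (Fin d₂) ℂ),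
    E.IsHermitian ∧ F.IsHermitian ∧ H₀ = E ⊗ₖ 1 + 1 ⊗ₖ F

/-- The unitary exchanging the two tensor factors, `|i⟩ ⊗ |j⟩ ↦ |j⟩ ⊗ |i⟩`. -/
def swapMatrix (d : ℕ) : Matrix (Fin d × Fin d) (Fin d × Fin d) ℂ :=
  Matrix.of fun p q => if p = q.swap then 1 else 0

/-- The coupling Hamiltonians of two indistinguishable subsystems: Hermitian and invariant under
exchange of the subsystems. -/
def IsSymHamiltonian {d : ℕ} (H₀ : Matrix (Fin d × Fin d) (Fin d × Fin d) ℂ) : Prop :=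
  H₀.IsHermitian ∧ swapMatrix d * H₀ * (swapMatrix d)ᴴ = H₀

/-- The bosonic state space `Sym²(ℂ^d)`. -/
def bosonicSpace (d : ℕ) : Submodule ℂ (Fin d × Fin d → ℂ) where
  carrier := {ψ | swapMatrix d *ᵥ ψ = ψ}
  zero_mem' := by simp
  add_mem' := by
    intro a b ha hb
    simp only [Set.mem_ofPred_eq] at *
    rw [Matrix.mulVec_add, ha, hb]
  smul_mem' := by
    intro c a ha
    simp only [Set.mem_ofPred_eq] at *
    rw [Matrix.mulVec_smul, ha]

/-- The fermionic state space `⋀²(ℂ^d)`. -/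
def fermionicSpace (d : ℕ) : Submodule ℂ (Fin d × Fin d → ℂ) where
  carrier := {ψ | swapMatrix d *ᵥ ψ = -ψ}
  zero_mem' := by simp
  add_mem' := by
    intro a b ha hb
    simp only [Set.mem_ofPred_eq] at *
    rw [Matrix.mulVec_add, ha, hb, neg_add]
  smul_mem' := by
    intro c a ha
    simp only [Set.mem_ofPred_eq] at *
    rw [Matrix.mulVec_smul, ha, smul_neg]

/-- `H₀` acts on the state space `S` of two indistinguishable subsystems as a local Hamiltonian
`E ⊗ 1 + 1 ⊗ E` with `E` Hermitian. -/
def IsLocalOn {d : ℕ} (S : Submodule ℂ (Fin d × Fin d → ℂ))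
    (H₀ : Matrix (Fin d × Fin d) (Fin d × Fin d) ℂ) : Prop :=
  ∃ E : Matrix (Fin d) (Fin d) ℂ, E.IsHermitian ∧
    ∀ ψ ∈ S, H₀ *ᵥ ψ = (E ⊗ₖ 1 + 1 ⊗ₖ E) *ᵥ ψ

/-! ### Diagonal states, projections and induced vector fields -/

/-- `diag(σ) = ∑ σ_i |i⟩ ⊗ |i⟩` for two subsystems of dimensions `d₁`, `d₂`. -/
def diagState (d₁ d₂ : ℕ) : (Fin (min d₁ d₂) → ℝ) →ₗ[ℝ] (Fin d₁ × Fin d₂ → ℂ) where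
  toFun σ := ∑ i, (σ i : ℂ) •
    ket (Fin.castLE (min_le_left d₁ d₂) i) (Fin.castLE (min_le_right d₁ d₂) i)
  map_add' σ τ := by simp [add_smul, Finset.sum_add_distrib]
  map_smul' c σ := by
    ext p
    simp [Finset.mul_sum, mul_assoc]

/-- The orthogonal projection onto the real diagonal states (for the real inner product
`Re ⟨·|·⟩`) followed by the inverse of `diagState`: `ψ ↦ (Re ⟨ii|ψ⟩)_i`. -/
def projDiag (d₁ d₂ : ℕ) : (Fin d₁ × Fin d₂ → ℂ) →ₗ[ℝ] (Fin (min d₁ d₂) → ℝ) where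
  toFun ψ i :=
    (ψ (Fin.castLE (min_le_left d₁ d₂) i, Fin.castLE (min_le_right d₁ d₂) i)).re
  map_add' ψ φ := by ext i; simp
  map_smul' c ψ := by ext i; simp

/-- `diag(σ) = ∑ σ_i |i⟩ ⊗ |i⟩` for bosons. -/
def diagStateSym (d : ℕ) : (Fin d → ℝ) →ₗ[ℝ] (Fin d × Fin d → ℂ) where
  toFun σ := ∑ i, (σ i : ℂ) • ket i i
  map_add' σ τ := by simp [add_smul, Finset.sum_add_distrib]
  map_smul' c σ := by
    ext p
    simp [Finset.mul_sum, mul_assoc]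

/-- `ψ ↦ (Re ⟨ii|ψ⟩)_i` for bosons. The formula is given on all of `ℂ^d ⊗ ℂ^d`; it is only applied
to elements of `Sym²(ℂ^d)`. -/
def projDiagSym (d : ℕ) : (Fin d × Fin d → ℂ) →ₗ[ℝ] (Fin d → ℝ) where
  toFun ψ i := (ψ (i, i)).re
  map_add' ψ φ := by ext i; simp
  map_smul' c ψ := by ext i; simp

/-- The index `2i - 1` (in the numbering from `1`) of the `i`-th `2 × 2` block. -/
def oddIdx {d : ℕ} (i : Fin (d / 2)) : Fin d := ⟨2 * i.1, by omega⟩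

/-- The index `2i` (in the numbering from `1`) of the `i`-th `2 × 2` block. -/
def evenIdx {d : ℕ} (i : Fin (d / 2)) : Fin d := ⟨2 * i.1 + 1, by omega⟩

/-- `qdiag(ξ) = (1/√2) ∑ ξ_i (|2i-1⟩ ⊗ |2i⟩ - |2i⟩ ⊗ |2i-1⟩)`. -/
def qdiagState (d : ℕ) : (Fin (d / 2) → ℝ) →ₗ[ℝ] (Fin d × Fin d → ℂ) where
  toFun ξ := ((1 / Real.sqrt 2 : ℝ) : ℂ) •
    ∑ i, (ξ i : ℂ) • (ket (oddIdx i) (evenIdx i) - ket (evenIdx i) (oddIdx i))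
  map_add' ξ η := by simp only [Pi.add_apply, Complex.ofReal_add, add_smul,
    Finset.sum_add_distrib, smul_add]
  map_smul' c ξ := by
    ext p
    simp only [Pi.smul_apply, smul_eq_mul, Complex.ofReal_mul, Finset.sum_apply, Finset.mul_sum,
      RingHom.id_apply, Complex.real_smul]
    refine Finset.sum_congr rfl fun i _ => ?_
    ring

/-- The orthogonal projection onto the real quasi-diagonal states (for the real inner product
`Re ⟨·|·⟩`) followed by the inverse of `qdiagState`: `ψ ↦ (√2 Re ⟨2i-1, 2i|ψ⟩)_i`. The formula is
given on all of `ℂ^d ⊗ ℂ^d`; it is only applied to elements of `⋀²(ℂ^d)`. -/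
def projQdiag (d : ℕ) : (Fin d × Fin d → ℂ) →ₗ[ℝ] (Fin (d / 2) → ℝ) where
  toFun ψ i := Real.sqrt 2 * (ψ (oddIdx i, evenIdx i)).re
  map_add' ψ φ := by ext i; simp [mul_add]
  map_smul' c ψ := by
    ext i
    simp
    ring

/-- The matrix of `Π ∘ U^* (i H₀) U ∘ D`, for real linear maps `D` from `ℝⁿ` into the states and
`Π` from the states to `ℝⁿ`. -/
def inducedField {m : Type*} [Fintype m] [DecidableEq m] {n : ℕ}
    (D : (Fin n → ℝ) →ₗ[ℝ] (m → ℂ)) (P : (m → ℂ) →ₗ[ℝ] (Fin n → ℝ)) (H₀ U : Matrix m m ℂ) :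
    Matrix (Fin n) (Fin n) ℝ :=
  LinearMap.toMatrix'
    (P ∘ₗ (Matrix.mulVecLin (Uᴴ * (Complex.I • H₀) * U)).restrictScalars ℝ ∘ₗ D)

/-- The induced vector field `H_U` for distinguishable subsystems. -/
def inducedDist {d₁ d₂ : ℕ} (H₀ U : Matrix (Fin d₁ × Fin d₂) (Fin d₁ × Fin d₂) ℂ) :
    Matrix (Fin (min d₁ d₂)) (Fin (min d₁ d₂)) ℝ :=
  inducedField (diagState d₁ d₂) (projDiag d₁ d₂) H₀ U

/-- The induced vector field `H_U^s` for bosons. -/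
def inducedBos {d : ℕ} (H₀ U : Matrix (Fin d × Fin d) (Fin d × Fin d) ℂ) :
    Matrix (Fin d) (Fin d) ℝ :=
  inducedField (diagStateSym d) (projDiagSym d) H₀ U

/-- The induced vector field `H_U^a` for fermions. -/
def inducedFer {d : ℕ} (H₀ U : Matrix (Fin d × Fin d) (Fin d × Fin d) ℂ) :
    Matrix (Fin (d / 2)) (Fin (d / 2)) ℝ :=
  inducedField (qdiagState d) (projQdiag d) H₀ U

/-! ### The operator lift `R' = -H_U R` on `SO(n)` -/

/-- `R` is a solution on `[0, T]` of `R'(t) = -X_{U(t)} R(t)` with control function `U`: the control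
is measurable with values in `K`, and `R` is an absolutely continuous path in `SO(n)` which
satisfies the equation almost everywhere. -/
structure IsLiftSolution {m : Type*} {n : ℕ} (K : Set (Matrix m m ℂ))
    (X : Matrix m m ℂ → Matrix (Fin n) (Fin n) ℝ) (T : ℝ)
    (U : ℝ → Matrix m m ℂ) (R : ℝ → Matrix (Fin n) (Fin n) ℝ) : Prop where
  control_mem : ∀ t ∈ Set.Icc 0 T, U t ∈ K
  control_measurable : ∀ a b, Measurable fun t : Set.Icc 0 T => U t a b
  mem_SO : ∀ t ∈ Set.Icc 0 T, R t ∈ specialOrthogonalGroup (Fin n) ℝ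
  absolutelyContinuous : ∀ i j, AbsolutelyContinuousOnInterval (fun t => R t i j) 0 T
  equation : ∀ᵐ t ∂(volume.restrict (Set.Icc 0 T)), ∀ i j,
    HasDerivAt (fun s => R s i j) ((-(X (U t)) * R t) i j) t

/-- The set of points reachable from `R₀` at time `T` by solutions of the operator lift. -/
def liftReach {m : Type*} {n : ℕ} (K : Set (Matrix m m ℂ))
    (X : Matrix m m ℂ → Matrix (Fin n) (Fin n) ℝ) (R₀ : Matrix (Fin n) (Fin n) ℝ) (T : ℝ) :
    Set (Matrix (Fin n) (Fin n) ℝ) :=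
  {R₁ | ∃ U R, IsLiftSolution K X T U R ∧ R 0 = R₀ ∧ R T = R₁}

/-- The operator lift is controllable on `SO(n)`: every point is reachable from every point in some
finite time. -/
def LiftControllable {m : Type*} {n : ℕ} (K : Set (Matrix m m ℂ))
    (X : Matrix m m ℂ → Matrix (Fin n) (Fin n) ℝ) : Prop :=
  ∀ R₁ ∈ specialOrthogonalGroup (Fin n) ℝ, ∀ R₂ ∈ specialOrthogonalGroup (Fin n) ℝ,
    ∃ T : ℝ, 0 ≤ T ∧ R₂ ∈ liftReach K X R₁ T

end Bipartite

end

/-! The equation is right-invariant, so the orthogonal matrices `g` for which every `R` in `SO(n)`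
can be steered to `g * R` form a submonoid of `O(n)`. It contains `exp(-t H_U)` for all `t ≥ 0` and
all controls `U`, and it suffices that it contains `SO(n)`. Three facts give this.

Symmetry. The entry `(i, j)` of `H_U` is minus the imaginary part of a matrix element of `H₀`
between states built from columns of the local unitaries, and it is skew because `H₀` is Hermitian.
Permuting and rephasing columns conjugates `H_U` by a signed permutation while staying in `K`. The
span of all `H_U` is therefore stable under the Weyl group, and by `mem_of_signedPermConj_stable`,
which also gives irreducibility, it is all of `so(n)` once a single `H_U` is nonzero.

Topology. Since the generators already span `so(n)` linearly, no Lie brackets are needed: products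
of exponentials with positive times contain an open subset of `O(n)`
(`interior_nonempty_of_exp_mem`). In a compact group, a submonoid with nonempty interior contains
the open subgroup it generates up to closure, and `SO(n)` consists of even products of reflections,
which connect to the identity (`mem_submonoid_of_det_eq_one`). The two facts are combined in
`liftControllable_of_signedPermConj`.

Nonvanishing. If every `H_U` is zero, rephasing also kills the real parts, so `H₀` has no matrix
elements between the corresponding states built from orthogonal vectors. Testing on basis vectors
and their combinations forces `H₀` to be local: `isLocal_of_productForm_eq_zero`,
`isLocalOn_bosonicSpace`, `isLocalOn_fermionicSpace`. -/

namespace Bipartite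

/-! ### Irreducibility of the action of the Weyl group on `so(n, ℝ)` -/

/-- The pullback of a matrix along a signed permutation. -/
def signedPermConj {n : ℕ} (π : Equiv.Perm (Fin n)) (ε : Fin n → ℤˣ)
    (M : Matrix (Fin n) (Fin n) ℝ) : Matrix (Fin n) (Fin n) ℝ :=
  Matrix.of fun i j => ((ε i : ℤ) : ℝ) * ((ε j : ℤ) : ℝ) * M (π i) (π j)

theorem transpose_signedPermMatrix_mul_mul {n : ℕ} (π : Equiv.Perm (Fin n)) (ε : Fin n → ℤˣ)
    (M : Matrix (Fin n) (Fin n) ℝ) :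
    (signedPermMatrix π ε)ᵀ * M * signedPermMatrix π ε = signedPermConj π ε M := by
  ext i j
  simp [signedPermMatrix, signedPermConj, Matrix.mul_apply]
  ring

/-- The generator `E_{ij} - E_{ji}` of `so(n, ℝ)`. -/
def skewUnit {n : ℕ} (i j : Fin n) : Matrix (Fin n) (Fin n) ℝ :=
  Matrix.single i j 1 - Matrix.single j i 1

theorem eq_sum_skewUnit {n : ℕ} {M : Matrix (Fin n) (Fin n) ℝ} (hM : Mᵀ = -M) :
    M = (1 / 2 : ℝ) • ∑ i, ∑ j, M i j • skewUnit i j := by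
  have h : ∀ i j, M j i = - M i j := fun i j => by simpa using congrFun₂ hM i j
  ext a b
  simp only [skewUnit, Matrix.smul_apply, Matrix.sum_apply, Matrix.sub_apply, Matrix.single_apply,
    smul_eq_mul, mul_sub, Finset.sum_sub_distrib]
  have h1 : ∑ i, ∑ j, M i j * (if i = a ∧ j = b then 1 else 0) = M a b := by
    simp [ite_and]
  have h2 : ∑ i, ∑ j, M i j * (if j = a ∧ i = b then 1 else 0) = M b a := by
    simp [ite_and]
  rw [h1, h2, h a b]
  ring

/-- The sign vector which is `-1` exactly at `i`. -/
def flipSign {n : ℕ} (i : Fin n) : Fin n → ℤˣ := fun k => if k = i then -1 else 1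

/-- Sign flips isolate a single nonzero entry pair of `X`, permutations move it to every position,
and the resulting `skewUnit`s span the skew matrices. -/
theorem mem_of_signedPermConj_stable {n : ℕ} (N : Submodule ℝ (Matrix (Fin n) (Fin n) ℝ))
    (hN : ∀ π ε, ∀ M ∈ N, signedPermConj π ε M ∈ N) {X : Matrix (Fin n) (Fin n) ℝ}
    (hX : X ∈ N) (hskew : Xᵀ = -X) (hne : X ≠ 0) {M : Matrix (Fin n) (Fin n) ℝ}
    (hM : Mᵀ = -M) : M ∈ N := by
  have hs : ∀ i j, X j i = - X i j := fun i j => by simpa using congrFun₂ hskew i j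
  obtain ⟨i, j, hij⟩ : ∃ i j, X i j ≠ 0 := by
    by_contra! h
    exact hne (by ext i j; simpa using h i j)
  have hii : ∀ k, X k k = 0 := fun k => by linarith [hs k k]
  have hne' : i ≠ j := by
    rintro rfl
    exact hij (hii i)
  have hunit : skewUnit i j ∈ N := by
    -- Subtracting the flip at `i` doubles the entries having exactly one index equal to `i` and
    -- kills the others. Doing the same at `j` leaves only the positions `(i, j)` and `(j, i)`,
    -- multiplied by 4.
    have h1 := N.sub_mem hX (hN 1 (flipSign i) X hX)
    have h2 := N.sub_mem h1 (hN 1 (flipSign j) _ h1)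
    have h3 := N.smul_mem (4 * X i j)⁻¹ h2
    convert h3 using 1
    have hji := hs i j
    have hXi := hii i
    have hXj := hii j
    clear h1 h2 h3 hN hM hs hii hX hne hskew
    obtain ⟨c, hc⟩ : ∃ c, X i j = c := ⟨_, rfl⟩
    rw [hc] at hij hji ⊢
    ext a b
    simp only [skewUnit, signedPermConj, flipSign, Matrix.sub_apply, Matrix.single_apply,
      Matrix.smul_apply, Matrix.of_apply, smul_eq_mul, Equiv.Perm.one_apply,
      @eq_comm _ i a, @eq_comm _ i b, @eq_comm _ j a, @eq_comm _ j b]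
    by_cases hai : a = i <;> by_cases haj : a = j <;> by_cases hbi : b = i <;>
      by_cases hbj : b = j <;> (try subst hai) <;> (try subst hbi) <;> (try subst haj) <;>
      (try subst hbj) <;> simp_all <;> (try field_simp) <;> norm_num
  have hall : ∀ k l, skewUnit k l ∈ N := by
    intro k l
    by_cases hkl : k = l
    · subst hkl
      simp [skewUnit]
    obtain ⟨π, hπk, hπl⟩ : ∃ π : Equiv.Perm (Fin n), π k = i ∧ π l = j := by
      -- First `k` is sent to `i`; the second swap then brings the image of `l` to `j` and fixes
      -- `i`.
      let π₁ := Equiv.swap k i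
      refine ⟨Equiv.swap (π₁ l) j * π₁, ?_, ?_⟩
      · have h1 : π₁ k = i := Equiv.swap_apply_left _ _
        rw [Equiv.Perm.mul_apply, h1]
        refine Equiv.swap_apply_of_ne_of_ne (fun h => hkl (π₁.injective (h1.trans h))) hne'
      · simp
    have := hN π (fun _ => 1) _ hunit
    convert this using 1
    ext a b
    simp only [skewUnit, signedPermConj, Matrix.sub_apply, Matrix.single_apply, Matrix.of_apply]
    simp [← hπk, ← hπl]
  rw [eq_sum_skewUnit hM]
  exact N.smul_mem _ (N.sum_mem fun k _ => N.sum_mem fun l _ => N.smul_mem _ (hall k l))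

/-- The element of the Weyl group acting on matrices by `signedPermConj π ε`. -/
theorem exists_weylRep_eq_signedPermConj {n : ℕ} (π : Equiv.Perm (Fin n)) (ε : Fin n → ℤˣ) :
    ∃ w : weylGroup n, ∀ Ω : LieAlgebra.Orthogonal.so (Fin n) ℝ,
      (weylRep n w Ω : Matrix (Fin n) (Fin n) ℝ) = signedPermConj π ε Ω := by
  let u : GL (Fin n) ℝ := ⟨signedPermMatrix π ε, (signedPermMatrix π ε)ᵀ,
    signedPermMatrix_mul_transpose π ε,
    mul_eq_one_comm.1 (signedPermMatrix_mul_transpose π ε)⟩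
  have hu : u ∈ weylGroup n := ⟨π, ε, rfl⟩
  -- The inverse appears because `signedPermConj` is `M ↦ wᵀ M w`, whereas the representation is `Ω
  -- ↦ w Ω w⁻¹`.
  refine ⟨⟨u, hu⟩⁻¹, fun Ω => ?_⟩
  rw [← transpose_signedPermMatrix_mul_mul]
  change ((u⁻¹ : GL (Fin n) ℝ) : Matrix (Fin n) (Fin n) ℝ) * Ω.1 *
    ((u⁻¹⁻¹ : GL (Fin n) ℝ) : Matrix (Fin n) (Fin n) ℝ) = _
  rw [inv_inv]
  rfl

/-- The inclusion of `so(n, ℝ)` into the space of matrices. -/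
def soInclusion (n : ℕ) :
    LieAlgebra.Orthogonal.so (Fin n) ℝ →ₗ[ℝ] Matrix (Fin n) (Fin n) ℝ where
  toFun Ω := Ω.1
  map_add' _ _ := rfl
  map_smul' _ _ := rfl

theorem weylRep_isIrreducible {n : ℕ} (hn : 2 ≤ n) : (weylRep n).IsIrreducible := by
  have hskew : ∀ Ω : LieAlgebra.Orthogonal.so (Fin n) ℝ, (Ω.1)ᵀ = -Ω.1 := fun Ω =>
    (LieAlgebra.Orthogonal.mem_so (Fin n) ℝ Ω.1).1 Ω.2
  have key : ∀ ρ : Subrepresentation (weylRep n), ρ ≠ ⊥ → ρ = ⊤ := by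
    intro ρ hρ
    have hsub : ρ.toSubmodule ≠ ⊥ := fun h => hρ (Subrepresentation.toSubmodule_injective h)
    obtain ⟨X, hX, hX0⟩ := Submodule.exists_mem_ne_zero_of_ne_bot hsub
    refine Subrepresentation.toSubmodule_injective ?_
    change ρ.toSubmodule = ⊤
    rw [eq_top_iff]
    rintro Y -
    have hmem : (Y : Matrix (Fin n) (Fin n) ℝ) ∈ ρ.toSubmodule.map (soInclusion n) := by
      refine mem_of_signedPermConj_stable _ ?_ (Submodule.mem_map_of_mem hX) (hskew X) ?_ (hskew Y)
      · rintro π ε M ⟨Ω, hΩ, rfl⟩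
        obtain ⟨w, hw⟩ := exists_weylRep_eq_signedPermConj π ε
        exact ⟨_, ρ.apply_mem_toSubmodule w hΩ, hw Ω⟩
      · exact fun h => hX0 (Subtype.ext h)
    obtain ⟨Z, hZ, hZY⟩ := hmem
    have : Z = Y := Subtype.ext hZY
    exact this ▸ hZ
  let i : Fin n := ⟨0, by omega⟩
  let j : Fin n := ⟨1, by omega⟩
  have hij : i ≠ j := by simp [i, j]
  have hA : skewUnit i j ∈ LieAlgebra.Orthogonal.so (Fin n) ℝ := by
    rw [LieAlgebra.Orthogonal.mem_so]
    simp [skewUnit]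
  have hnt : (⊥ : Subrepresentation (weylRep n)) ≠ ⊤ := by
    intro h
    have h1 : (⟨skewUnit i j, hA⟩ : LieAlgebra.Orthogonal.so (Fin n) ℝ) ∈
        (⊥ : Subrepresentation (weylRep n)).toSubmodule := by
      rw [h]
      exact Submodule.mem_top
    have h2 : skewUnit i j = 0 := congrArg Subtype.val ((Submodule.mem_bot ℝ).1 h1)
    have h3 := congrFun₂ h2 i j
    simp [skewUnit, hij, hij.symm] at h3
  exact { exists_pair_ne := ⟨⊥, ⊤, hnt⟩
          eq_bot_or_eq_top := fun ρ => or_iff_not_imp_left.2 (key ρ) }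

/-! ### Submonoids of the orthogonal group with nonempty interior -/

/-- The matrix of the reflection in the hyperplane orthogonal to the unit vector `v`. -/
def householder {n : ℕ} (v : EuclideanSpace ℝ (Fin n)) : Matrix (Fin n) (Fin n) ℝ :=
  1 - (2 : ℝ) • vecMulVec v.ofLp v.ofLp

theorem dotProduct_self_of_norm_eq_one {n : ℕ} {v : EuclideanSpace ℝ (Fin n)} (hv : ‖v‖ = 1) :
    v.ofLp ⬝ᵥ v.ofLp = 1 := by
  have h := EuclideanSpace.real_norm_sq_eq v
  rw [hv] at h
  simp only [dotProduct, ← sq]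
  linarith

theorem householder_mul_self {n : ℕ} {v : EuclideanSpace ℝ (Fin n)} (hv : ‖v‖ = 1) :
    householder v * householder v = 1 := by
  simp only [householder, mul_sub, sub_mul, mul_one, one_mul, smul_mul_assoc, mul_smul_comm,
    vecMulVec_mul_vecMulVec, dotProduct_self_of_norm_eq_one hv, one_smul]
  module

theorem householder_transpose {n : ℕ} (v : EuclideanSpace ℝ (Fin n)) :
    (householder v)ᵀ = householder v := by
  simp [householder, transpose_vecMulVec]

theorem householder_mem_unitaryGroup {n : ℕ} {v : EuclideanSpace ℝ (Fin n)} (hv : ‖v‖ = 1) :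
    householder v ∈ unitaryGroup (Fin n) ℝ := by
  rw [mem_unitaryGroup_iff, star_eq_conjTranspose, conjTranspose_eq_transpose_of_trivial,
    householder_transpose, householder_mul_self hv]

theorem det_householder {n : ℕ} {v : EuclideanSpace ℝ (Fin n)} (hv : ‖v‖ = 1) :
    (householder v).det = -1 := by
  have h := det_one_add_replicateCol_mul_replicateRow (ι := Unit) ((-2 : ℝ) • v.ofLp) v.ofLp
  rw [dotProduct_smul, dotProduct_self_of_norm_eq_one hv] at h
  have e : householder v = 1 + replicateCol Unit ((-2 : ℝ) • v.ofLp) * replicateRow Unit v.ofLp := by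
    ext i j
    simp [householder, vecMulVec_apply, Matrix.mul_apply]
    ring
  rw [e, h]
  norm_num

/-- The matrix of a linear isometry of Euclidean space. -/
noncomputable def isometryMatrix (n : ℕ) :
    (EuclideanSpace ℝ (Fin n) ≃ₗᵢ[ℝ] EuclideanSpace ℝ (Fin n)) →* Matrix (Fin n) (Fin n) ℝ :=
  ((toEuclideanCLM (𝕜 := ℝ) (n := Fin n)).symm : _ →* Matrix (Fin n) (Fin n) ℝ).comp
    ((Submonoid.subtype _).comp (Unitary.linearIsometryEquiv
      (𝕜 := ℝ) (H := EuclideanSpace ℝ (Fin n))).symm.toMonoidHom)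

theorem isometryMatrix_reflection {n : ℕ} {v : EuclideanSpace ℝ (Fin n)} (hv : ‖v‖ = 1) :
    isometryMatrix n (ℝ ∙ v)ᗮ.reflection = householder v := by
  refine (toEuclideanCLM (𝕜 := ℝ) (n := Fin n)).injective ?_
  refine ((toEuclideanCLM (𝕜 := ℝ) (n := Fin n)).apply_symm_apply _).trans ?_
  ext x i
  have h : (ℝ ∙ v)ᗮ.reflection x = x - 2 • (inner ℝ v x) • v := by
    rw [Submodule.reflection_orthogonal_apply, Submodule.reflection_singleton_apply, hv]
    simp
  change ((ℝ ∙ v)ᗮ.reflection x) i = (toEuclideanCLM (𝕜 := ℝ) (n := Fin n) (householder v) x) i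
  rw [h, ofLp_toEuclideanCLM, householder, sub_mulVec, one_mulVec, smul_mulVec, vecMulVec_mulVec]
  simp [PiLp.inner_apply, dotProduct, mul_comm]

/-- The Cartan–Dieudonné theorem, transported to matrices and normalized to unit vectors. -/
theorem exists_list_householder {n : ℕ} {R : Matrix (Fin n) (Fin n) ℝ}
    (hR : R ∈ unitaryGroup (Fin n) ℝ) :
    ∃ l : List (Metric.sphere (0 : EuclideanSpace ℝ (Fin n)) 1),
      R = (l.map fun v => householder v.1).prod := by
  let f := toEuclideanCLM (𝕜 := ℝ) (n := Fin n)
  let u : unitary (EuclideanSpace ℝ (Fin n) →L[ℝ] EuclideanSpace ℝ (Fin n)) :=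
    ⟨f R, Unitary.map_mem f hR⟩
  obtain ⟨l, -, hl⟩ := (Unitary.linearIsometryEquiv u).reflections_generate_dim
  have hu : isometryMatrix n (Unitary.linearIsometryEquiv u) = R := by
    change f.symm ((Unitary.linearIsometryEquiv.symm (Unitary.linearIsometryEquiv u)).1) = R
    rw [MulEquiv.symm_apply_apply]
    exact f.symm_apply_apply R
  rw [← hu, hl]
  clear hl hu u
  induction l with
  | nil => exact ⟨[], by simp⟩
  | cons v t ih =>
    obtain ⟨l', hl'⟩ := ih
    rw [List.map_cons, List.prod_cons, map_mul, hl']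
    -- A zero vector in the list contributes the identity and is dropped.
    by_cases hv : v = 0
    · refine ⟨l', ?_⟩
      have : (ℝ ∙ v)ᗮ.reflection = 1 := by
        ext x : 1
        subst hv
        exact Submodule.reflection_mem_subspace_eq_self (by simp)
      rw [this, map_one, one_mul]
    · have hn : ‖(‖v‖⁻¹ • v)‖ = 1 := norm_smul_inv_norm (𝕜 := ℝ) hv
      have hs : (ℝ ∙ v) = ℝ ∙ (‖v‖⁻¹ • v) :=
        (Submodule.span_singleton_smul_eq
          (IsUnit.mk0 _ (inv_ne_zero (norm_ne_zero_iff.2 hv))) v).symm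
      refine ⟨⟨‖v‖⁻¹ • v, by simpa using hn⟩ :: l', ?_⟩
      have h2 : isometryMatrix n (ℝ ∙ v)ᗮ.reflection = householder (‖v‖⁻¹ • v) := by
        rw [← isometryMatrix_reflection hn]
        congr! 3
      rw [h2, List.map_cons, List.prod_cons]

instance compactSpace_unitaryGroup (n : ℕ) : CompactSpace (unitaryGroup (Fin n) ℝ) := by
  refine isCompact_iff_compactSpace.1 ?_
  have hK : IsCompact (Set.univ.pi fun _ : Fin n => Set.univ.pi fun _ : Fin n =>
      Set.Icc (-1 : ℝ) 1) :=
    isCompact_univ_pi fun _ => isCompact_univ_pi fun _ => isCompact_Icc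
  refine IsCompact.of_isClosed_subset hK ?_ ?_
  · have : ((unitaryGroup (Fin n) ℝ : Submonoid _) : Set (Matrix (Fin n) (Fin n) ℝ))
        = {A | A * star A = 1} := by
      ext A
      exact mem_unitaryGroup_iff
    rw [this]
    exact isClosed_eq (by fun_prop) continuous_const
  · intro A hA i _ j _
    exact abs_le.1 (entry_norm_bound_of_unitary hA i j)

/-- An open subgroup is clopen, and the unit sphere is connected for `n ≥ 2`. For fixed `v`, the set
of `u` with `r u * r v ∈ H` is clopen and contains `v`, hence is the whole sphere. Determinant 1
means an even number of reflections, which can be grouped in pairs. -/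
theorem mem_of_isOpen_of_det_eq_one {n : ℕ} (hn : 2 ≤ n) (H : Subgroup (unitaryGroup (Fin n) ℝ))
    (hH : IsOpen (H : Set (unitaryGroup (Fin n) ℝ))) (R : unitaryGroup (Fin n) ℝ)
    (hdet : R.1.det = 1) : R ∈ H := by
  let S := Metric.sphere (0 : EuclideanSpace ℝ (Fin n)) 1
  have hS : ∀ v : S, ‖v.1‖ = 1 := fun v => by simp
  let r : S → unitaryGroup (Fin n) ℝ := fun v =>
    ⟨householder v.1, householder_mem_unitaryGroup (hS v)⟩
  have hr : Continuous r := by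
    refine Continuous.subtype_mk ?_ _
    unfold householder
    fun_prop
  have hrr : ∀ v, r v * r v = 1 := fun v => Subtype.ext (householder_mul_self (hS v))
  have hconn : PreconnectedSpace S := by
    refine isPreconnected_iff_preconnectedSpace.1 (isPreconnected_sphere ?_ _ _)
    rw [← Module.finrank_eq_rank, finrank_euclideanSpace_fin]
    exact_mod_cast hn
  have hpair : ∀ u v, r u * r v ∈ H := by
    intro u v
    have hcl : IsClopen {u | r u * r v ∈ H} := by
      have hc : Continuous fun u => r u * r v := hr.mul continuous_const
      exact ⟨(Subgroup.isClosed_of_isOpen H hH).preimage hc, hH.preimage hc⟩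
    have huniv : {u | r u * r v ∈ H} = Set.univ :=
      hcl.eq_univ ⟨v, by change r v * r v ∈ H; rw [hrr]; exact H.one_mem⟩
    exact (Set.eq_univ_iff_forall.1 huniv) u
  have heven : ∀ (k : ℕ) (l : List S), l.length = 2 * k → (l.map r).prod ∈ H := by
    intro k
    induction k with
    | zero =>
      intro l hl
      rw [List.length_eq_zero_iff.1 (by omega : l.length = 0)]
      exact H.one_mem
    | succ k ih =>
      rintro (_ | ⟨a, _ | ⟨b, l⟩⟩) hl
      · simp at hl
      · simp at hl
        omega
      · rw [List.map_cons, List.map_cons, List.prod_cons, List.prod_cons, ← mul_assoc]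
        exact H.mul_mem (hpair a b) (ih l (by simp at hl; omega))
  obtain ⟨l, hl⟩ := exists_list_householder R.2
  have hval : R = (l.map r).prod := by
    refine Subtype.ext (hl.trans ?_)
    rw [Submonoid.coe_list_prod, List.map_map]
    rfl
  have hd : R.1.det = (-1) ^ l.length := by
    rw [hl]
    clear hl hval
    induction l with
    | nil => simp
    | cons a t ih =>
      rw [List.map_cons, List.prod_cons, det_mul, ih, det_householder (hS a), List.length_cons,
        pow_succ']
  rw [hdet] at hd
  have hev : Even l.length := by
    by_contra hodd
    rw [Nat.not_even_iff_odd] at hodd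
    rw [hodd.neg_one_pow] at hd
    norm_num at hd
  obtain ⟨k, hk⟩ := hev
  rw [hval]
  exact heven k l (by omega)

/-- By compactness `S` is dense in the subgroup it generates, which is open because `S` has an
interior point `g`. An approximation `h ∈ S` of `R * g⁻¹` makes `h⁻¹ * R` close to `g`, hence an
element of `S`, and `R = h * (h⁻¹ * R)`. -/
theorem mem_submonoid_of_det_eq_one {n : ℕ} (hn : 2 ≤ n)
    (S : Submonoid (unitaryGroup (Fin n) ℝ))
    (hS : (interior (S : Set (unitaryGroup (Fin n) ℝ))).Nonempty) (R : unitaryGroup (Fin n) ℝ)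
    (hdet : R.1.det = 1) : R ∈ S := by
  obtain ⟨g, hg⟩ := hS
  let H := Subgroup.closure (S : Set (unitaryGroup (Fin n) ℝ))
  have hSH : (S : Set (unitaryGroup (Fin n) ℝ)) ⊆ H := Subgroup.subset_closure
  have hopen : IsOpen (H : Set (unitaryGroup (Fin n) ℝ)) :=
    H.isOpen_of_mem_nhds (Filter.mem_of_superset (mem_interior_iff_mem_nhds.1 hg) hSH)
  have hRH : R ∈ H := mem_of_isOpen_of_det_eq_one hn H hopen R hdet
  have hcl : R * g⁻¹ ∈ closure (S : Set (unitaryGroup (Fin n) ℝ)) := by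
    have h := closure_submonoidClosure_eq_closure_subgroupClosure
      (S : Set (unitaryGroup (Fin n) ℝ))
    rw [Submonoid.closure_eq] at h
    rw [h]
    exact subset_closure (H.mul_mem hRH (H.inv_mem (hSH (interior_subset hg))))
  have hO : IsOpen {h : unitaryGroup (Fin n) ℝ |
      h⁻¹ * R ∈ interior (S : Set (unitaryGroup (Fin n) ℝ))} :=
    isOpen_interior.preimage (continuous_inv.mul continuous_const)
  obtain ⟨h, hhO, hhS⟩ := mem_closure_iff.1 hcl _ hO (by simpa using hg)
  have := S.mul_mem hhS (interior_subset hhO : h⁻¹ * R ∈ S)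
  simpa using this

/-! ### Steering along piecewise exponential paths -/

section Exponential

attribute [local instance] Matrix.linftyOpNormedRing Matrix.linftyOpNormedAlgebra

theorem hasDerivAt_exp_smul_mul_apply {n : ℕ} (A B : Matrix (Fin n) (Fin n) ℝ) (t : ℝ)
    (i j : Fin n) :
    HasDerivAt (fun s : ℝ => (NormedSpace.exp (s • A) * B) i j)
      ((A * (NormedSpace.exp (t • A) * B)) i j) t := by
  have h := (hasDerivAt_exp_smul_const' (𝕂 := ℝ) A t).mul_const B
  have h2 := (LinearMap.toContinuousLinearMap
    (Matrix.entryLinearMap ℝ ℝ i j)).hasFDerivAt.comp_hasDerivAt t h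
  rw [mul_assoc] at h2
  exact h2

end Exponential

theorem exp_mul_transpose_of_skew {n : ℕ} {A : Matrix (Fin n) (Fin n) ℝ} (hA : Aᵀ = -A) :
    NormedSpace.exp A * (NormedSpace.exp A)ᵀ = 1 := by
  rw [← exp_transpose, hA, ← exp_add_of_commute _ _ (Commute.neg_right (Commute.refl A)),
    add_neg_cancel, NormedSpace.exp_zero]

theorem exp_mem_specialOrthogonalGroup {n : ℕ} {A : Matrix (Fin n) (Fin n) ℝ} (hA : Aᵀ = -A) :
    NormedSpace.exp A ∈ specialOrthogonalGroup (Fin n) ℝ := by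
  have h := exp_mul_transpose_of_skew hA
  refine mem_specialOrthogonalGroup_iff.2 ⟨(mem_orthogonalGroup_iff _ _).2 h, ?_⟩
  have hd := congrArg Matrix.det h
  rw [det_mul, det_transpose, det_one] at hd
  -- Being a square, the determinant is nonnegative, which excludes the value -1.
  have hsq : (NormedSpace.exp A).det = (NormedSpace.exp ((1 / 2 : ℝ) • A)).det ^ 2 := by
    rw [sq, ← det_mul, ← exp_add_of_commute _ _ (Commute.refl _), ← add_smul]
    norm_num
  nlinarith [sq_nonneg (NormedSpace.exp ((1 / 2 : ℝ) • A)).det]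

theorem mul_transpose_of_mem_specialOrthogonalGroup {n : ℕ} {R : Matrix (Fin n) (Fin n) ℝ}
    (hR : R ∈ specialOrthogonalGroup (Fin n) ℝ) : R * Rᵀ = 1 :=
  (mem_orthogonalGroup_iff (Fin n) ℝ).1 (mem_specialOrthogonalGroup_iff.1 hR).1

theorem abs_apply_le_one_of_mem_specialOrthogonalGroup {n : ℕ} {R : Matrix (Fin n) (Fin n) ℝ}
    (hR : R ∈ specialOrthogonalGroup (Fin n) ℝ) (i j : Fin n) : |R i j| ≤ 1 :=
  entry_norm_bound_of_unitary (𝕜 := ℝ)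
    (mem_unitaryGroup_iff.2 (mul_transpose_of_mem_specialOrthogonalGroup hR)) i j

/-! ### Concatenation of solutions -/

section Steering

variable {m : Type*} {n : ℕ} (K : Set (Matrix m m ℂ))
  (X : Matrix m m ℂ → Matrix (Fin n) (Fin n) ℝ)

/-- `R₂` is reachable from `R₁` along a Lipschitz path which satisfies the equation outside of
finitely many times. -/
def Steers (R₁ R₂ : Matrix (Fin n) (Fin n) ℝ) : Prop :=
  ∃ T : ℝ, 0 ≤ T ∧ ∃ (U : ℝ → Matrix m m ℂ) (R : ℝ → Matrix (Fin n) (Fin n) ℝ),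
    R 0 = R₁ ∧ R T = R₂ ∧ (∀ t, U t ∈ K) ∧ (∀ a b, Measurable fun t => U t a b) ∧
    (∀ t, R t ∈ specialOrthogonalGroup (Fin n) ℝ) ∧
    (∃ C : NNReal, ∀ i j, LipschitzWith C fun t => R t i j) ∧
    ∃ s : Set ℝ, s.Finite ∧ ∀ t ∈ Set.Icc 0 T, t ∉ s → ∀ i j,
      HasDerivAt (fun s => R s i j) ((-(X (U t)) * R t) i j) t

variable {K X}

/-- Lipschitz paths are absolutely continuous and finite sets are null. The stronger notion, with
controls and paths defined at all times, is the one that concatenates easily. -/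
theorem Steers.exists_mem_liftReach {R₁ R₂ : Matrix (Fin n) (Fin n) ℝ} (h : Steers K X R₁ R₂) :
    ∃ T : ℝ, 0 ≤ T ∧ R₂ ∈ liftReach K X R₁ T := by
  obtain ⟨T, hT, U, R, h0, h1, hK, hm, hSO, ⟨C, hC⟩, s, hs, hd⟩ := h
  refine ⟨T, hT, U, R, ⟨fun t _ => hK t, fun a b => (hm a b).comp measurable_subtype_coe,
    fun t _ => hSO t, fun i j => ((hC i j).lipschitzOnWith).absolutelyContinuousOnInterval, ?_⟩,
    h0, h1⟩
  rw [ae_restrict_iff' measurableSet_Icc]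
  have hnull : ∀ᵐ t : ℝ, t ∉ s := hs.countable.ae_notMem _
  filter_upwards [hnull] with t ht htI
  exact hd t htI ht

theorem Steers.refl (hne : K.Nonempty) {R₁ : Matrix (Fin n) (Fin n) ℝ}
    (hR : R₁ ∈ specialOrthogonalGroup (Fin n) ℝ) : Steers K X R₁ R₁ := by
  obtain ⟨U, hU⟩ := hne
  -- The interval is the single time 0, which is declared exceptional because the constant path need
  -- not satisfy the equation there.
  refine ⟨0, le_rfl, fun _ => U, fun _ => R₁, rfl, rfl, fun _ => hU, fun _ _ => measurable_const,
    fun _ => hR, ⟨0, fun _ _ => LipschitzWith.const _⟩, {0}, Set.finite_singleton _, ?_⟩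
  intro t ht h0
  exact absurd (by simpa using ht) h0

theorem Steers.exp {U : Matrix m m ℂ} (hU : U ∈ K) (hskew : (X U)ᵀ = -X U) {t : ℝ} (ht : 0 ≤ t)
    {R₁ : Matrix (Fin n) (Fin n) ℝ} (hR : R₁ ∈ specialOrthogonalGroup (Fin n) ℝ) :
    Steers K X R₁ (NormedSpace.exp (t • -X U) * R₁) := by
  have hSO : ∀ s : ℝ, NormedSpace.exp (s • -X U) * R₁ ∈ specialOrthogonalGroup (Fin n) ℝ :=
    fun s => mul_mem (exp_mem_specialOrthogonalGroup (by simp [hskew])) hR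
  have hd := hasDerivAt_exp_smul_mul_apply (-X U) R₁
  refine ⟨t, ht, fun _ => U, fun s => NormedSpace.exp (s • -X U) * R₁, by simp, rfl, fun _ => hU,
    fun _ _ => measurable_const, hSO, ?_, ∅, Set.finite_empty, fun s _ _ i j => hd s i j⟩
  refine ⟨∑ i, ∑ k, ‖X U i k‖₊, fun i j => ?_⟩
  refine lipschitzWith_of_nnnorm_deriv_le (fun s => (hd s i j).differentiableAt) fun s => ?_
  rw [(hd s i j).deriv, Matrix.mul_apply]
  refine (nnnorm_sum_le _ _).trans ?_
  have h1 : ∀ k, ‖(-X U) i k * (NormedSpace.exp (s • -X U) * R₁) k j‖₊ ≤ ‖X U i k‖₊ := by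
    intro k
    rw [nnnorm_mul, Matrix.neg_apply, nnnorm_neg]
    exact mul_le_of_le_one_right' (abs_apply_le_one_of_mem_specialOrthogonalGroup (hSO s) k j)
  exact (Finset.sum_le_sum fun k _ => h1 k).trans
    (Finset.single_le_sum (f := fun i => ∑ k, ‖X U i k‖₊) (fun _ _ => zero_le)
      (Finset.mem_univ i))

theorem Steers.trans {R₁ R₂ R₃ : Matrix (Fin n) (Fin n) ℝ} (h₁ : Steers K X R₁ R₂)
    (h₂ : Steers K X R₂ R₃) : Steers K X R₁ R₃ := by
  obtain ⟨S, hS, U, P, hP0, hPS, hUK, hUm, hPSO, ⟨C, hC⟩, s, hs, hPd⟩ := h₁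
  obtain ⟨T, hT, V, Q, hQ0, hQT, hVK, hVm, hQSO, ⟨D, hD⟩, r, hr, hQd⟩ := h₂
  -- In this form the glued path is visibly Lipschitz. The junction time `S` joins the exceptional
  -- set.
  have hglue : ∀ t, (if t ≤ S then P t else Q (t - S)) = P (min t S) + Q (max (t - S) 0) - R₂ := by
    intro t
    split_ifs with h
    · rw [min_eq_left h, max_eq_right (by linarith), hQ0]
      abel
    · push Not at h
      rw [min_eq_right h.le, max_eq_left (by linarith), hPS]
      abel
  refine ⟨S + T, by positivity, fun t => if t ≤ S then U t else V (t - S),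
    fun t => if t ≤ S then P t else Q (t - S), ?_, ?_, ?_, ?_, ?_, ?_,
    s ∪ ((fun t => t + S) '' r) ∪ {S}, (hs.union (hr.image _)).union (Set.finite_singleton _), ?_⟩
  · simp [hS, hP0]
  · refine (hglue _).trans ?_
    rw [min_eq_right (by linarith), max_eq_left (by linarith), hPS, add_sub_cancel_left,
      add_sub_cancel_left, hQT]
  · intro t
    dsimp only
    split_ifs
    exacts [hUK _, hVK _]
  · intro a b
    have : (fun t => (if t ≤ S then U t else V (t - S)) a b)
        = fun t => if t ≤ S then U t a b else V (t - S) a b := by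
      funext t
      split_ifs <;> rfl
    rw [this]
    exact Measurable.ite measurableSet_Iic (hUm a b)
      ((hVm a b).comp (measurable_id.sub_const S))
  · intro t
    dsimp only
    split_ifs
    exacts [hPSO _, hQSO _]
  · simp only [hglue]
    exact ⟨_, fun i j => (((hC i j).comp (LipschitzWith.id.min_const S)).add
      ((hD i j).comp ((LipschitzWith.id.sub (LipschitzWith.const S)).max_const 0))).sub
      (LipschitzWith.const (R₂ i j))⟩
  · intro t ht hts i j
    simp only [Set.mem_union, Set.mem_image, Set.mem_singleton_iff, not_or, not_exists,
      not_and] at hts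
    change HasDerivAt (fun s => (if s ≤ S then P s else Q (s - S)) i j)
      ((-X (if t ≤ S then U t else V (t - S)) * (if t ≤ S then P t else Q (t - S))) i j) t
    rcases lt_or_gt_of_ne hts.2 with hlt | hgt
    · have he : (fun t => (if t ≤ S then P t else Q (t - S)) i j) =ᶠ[nhds t] fun t => P t i j := by
        filter_upwards [Iio_mem_nhds hlt] with u hu
        rw [if_pos (le_of_lt hu)]
      rw [if_pos hlt.le, if_pos hlt.le]
      exact (hPd t ⟨ht.1, hlt.le⟩ hts.1.1 i j).congr_of_eventuallyEq he
    · have he : (fun t => (if t ≤ S then P t else Q (t - S)) i j) =ᶠ[nhds t]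
          fun t => Q (t - S) i j := by
        filter_upwards [Ioi_mem_nhds hgt] with u hu
        rw [if_neg (not_le_of_gt hu)]
      rw [if_neg (not_le_of_gt hgt), if_neg (not_le_of_gt hgt)]
      have h := hQd (t - S) ⟨by linarith, by linarith [ht.2]⟩
        (fun hmem => hts.1.2 _ hmem (by ring)) i j
      exact (h.comp_sub_const t S).congr_of_eventuallyEq he

end Steering

/-! ### Controllability of the operator lift -/

theorem hasStrictFDerivAt_mul_of_eq_one {E 𝔸 : Type*} [NormedAddCommGroup E] [NormedSpace ℝ E]
    [NormedRing 𝔸] [NormedAlgebra ℝ 𝔸] {a b : E → 𝔸} {a' b' : E →L[ℝ] 𝔸} {x : E}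
    (ha : HasStrictFDerivAt a a' x) (hb : HasStrictFDerivAt b b' x) (hax : a x = 1)
    (hbx : b x = 1) : HasStrictFDerivAt (fun y => a y * b y) (a' + b') x := by
  have h := ha.mul' hb
  rw [hax, hbx, MulOpposite.op_one, one_smul, one_smul, add_comm] at h
  exact h

/-! ### Products of exponentials fill an open set -/

section Interior

attribute [local instance] Matrix.linftyOpNormedRing Matrix.linftyOpNormedAlgebra

variable {n : ℕ} {ι : Type*} (A : ι → Matrix (Fin n) (Fin n) ℝ)

/-- The ordered product of the exponentials of `t k • A k`. -/
noncomputable def expProd (l : List ι) (t : ι → ℝ) : Matrix (Fin n) (Fin n) ℝ :=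
  (l.map fun k => NormedSpace.exp (t k • A k)).prod

/-- The derivative of `expProd` at the origin. -/
noncomputable def expProdDeriv (l : List ι) : (ι → ℝ) →L[ℝ] Matrix (Fin n) (Fin n) ℝ :=
  (l.map fun k => (ContinuousLinearMap.proj (R := ℝ) (φ := fun _ : ι => ℝ) k).smulRight (A k)).sum

theorem expProd_zero (l : List ι) : expProd A l 0 = 1 := by
  simp [expProd]

theorem hasStrictFDerivAt_expProd [Fintype ι] (l : List ι) :
    HasStrictFDerivAt (expProd A l) (expProdDeriv A l) 0 := by
  induction l with
  | nil => exact hasStrictFDerivAt_const 1 0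
  | cons k l ih =>
    let p : (ι → ℝ) →L[ℝ] Matrix (Fin n) (Fin n) ℝ :=
      (ContinuousLinearMap.proj (R := ℝ) (φ := fun _ : ι => ℝ) k).smulRight (A k)
    have hp : p 0 = 0 := map_zero p
    have h1 : HasStrictFDerivAt (fun t => NormedSpace.exp (p t)) p 0 := by
      have he : HasStrictFDerivAt (NormedSpace.exp : Matrix (Fin n) (Fin n) ℝ → _)
          (1 : Matrix (Fin n) (Fin n) ℝ →L[ℝ] _) (p 0) := by
        rw [hp]
        exact hasStrictFDerivAt_exp_zero
      exact he.comp (0 : ι → ℝ) p.hasStrictFDerivAt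
    exact hasStrictFDerivAt_mul_of_eq_one h1 ih (by simp)
      (expProd_zero A l)

theorem expProdDeriv_toList_apply [Fintype ι] (t : ι → ℝ) :
    expProdDeriv A Finset.univ.toList t = ∑ k, t k • A k := by
  rw [expProdDeriv, Finset.sum_map_toList]
  simp

/-- To avoid charts on `O(n)`, the product of exponentials is multiplied by a symmetric factor `1 +
τ Z`. The derivative at the origin then reaches the skew matrices through the times and the
symmetric ones through `Z`, so the map is open near the origin into the space of all matrices. On
orthogonal values the symmetric factor must be 1. -/
theorem interior_nonempty_of_exp_mem [Fintype ι] (hskew : ∀ k, (A k)ᵀ = -A k)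
    (hspan : ∀ M : Matrix (Fin n) (Fin n) ℝ, Mᵀ = -M → ∃ c : ι → ℝ, ∑ k, c k • A k = M)
    (S : Submonoid (unitaryGroup (Fin n) ℝ))
    (hS : ∀ k, ∀ t : ℝ, 0 ≤ t → ∀ g : unitaryGroup (Fin n) ℝ,
      g.1 = NormedSpace.exp (t • A k) → g ∈ S) :
    (interior (S : Set (unitaryGroup (Fin n) ℝ))).Nonempty := by
  have : CompleteSpace (Matrix (Fin n) (Fin n) ℝ) := FiniteDimensional.complete ℝ _
  let l : List ι := Finset.univ.toList
  have hmem : ∀ t : ι → ℝ, (∀ k, 0 ≤ t k) → ∃ h ∈ S, h.1 = expProd A l t := by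
    intro t ht
    have hexp : ∀ k, NormedSpace.exp (t k • A k) ∈ unitaryGroup (Fin n) ℝ := fun k =>
      mem_unitaryGroup_iff.2 (exp_mul_transpose_of_skew (by simp [hskew k]))
    refine ⟨(l.map fun k => (⟨_, hexp k⟩ : unitaryGroup (Fin n) ℝ)).prod, ?_, ?_⟩
    · refine S.list_prod_mem fun g hg => ?_
      obtain ⟨k, -, rfl⟩ := List.mem_map.1 hg
      exact hS k (t k) (ht k) _ rfl
    · rw [Submonoid.coe_list_prod, List.map_map]
      rfl
  let τ : Matrix (Fin n) (Fin n) ℝ →L[ℝ] Matrix (Fin n) (Fin n) ℝ :=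
    LinearMap.toContinuousLinearMap
      (LinearMap.id + (Matrix.transposeLinearEquiv (Fin n) (Fin n) ℝ ℝ).toLinearMap)
  have hτ : ∀ Z, τ Z = Z + Zᵀ := fun Z => rfl
  let f : (ι → ℝ) × Matrix (Fin n) (Fin n) ℝ → Matrix (Fin n) (Fin n) ℝ :=
    fun p => expProd A l p.1 * (1 + τ p.2)
  let f' : (ι → ℝ) × Matrix (Fin n) (Fin n) ℝ →L[ℝ] Matrix (Fin n) (Fin n) ℝ :=
    (expProdDeriv A l).comp (ContinuousLinearMap.fst ℝ _ _) +
      τ.comp (ContinuousLinearMap.snd ℝ _ _)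
  have hf : HasStrictFDerivAt f f' 0 := by
    have h1 : HasStrictFDerivAt (fun p : (ι → ℝ) × Matrix (Fin n) (Fin n) ℝ => expProd A l p.1)
        ((expProdDeriv A l).comp (ContinuousLinearMap.fst ℝ _ _)) 0 :=
      HasStrictFDerivAt.comp (g := expProd A l) (0 : (ι → ℝ) × Matrix (Fin n) (Fin n) ℝ)
        (hasStrictFDerivAt_expProd A l) hasStrictFDerivAt_fst
    have h2 : HasStrictFDerivAt
        (fun p : (ι → ℝ) × Matrix (Fin n) (Fin n) ℝ => (1 : Matrix (Fin n) (Fin n) ℝ) + τ p.2)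
        (τ.comp (ContinuousLinearMap.snd ℝ _ _)) 0 :=
      ((τ.comp (ContinuousLinearMap.snd ℝ (ι → ℝ) _)).hasStrictFDerivAt).const_add 1
    exact hasStrictFDerivAt_mul_of_eq_one h1 h2 (expProd_zero A l)
      (by rw [Prod.snd_zero, map_zero, add_zero])
  have hsurj : f'.range = ⊤ := by
    rw [LinearMap.range_eq_top]
    intro M
    obtain ⟨c, hc⟩ := hspan ((1 / 2 : ℝ) • (M - Mᵀ)) (by
      rw [transpose_smul, transpose_sub, transpose_transpose, ← smul_neg, neg_sub])
    refine ⟨(c, (1 / 4 : ℝ) • (M + Mᵀ)), ?_⟩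
    change expProdDeriv A l c + τ ((1 / 4 : ℝ) • (M + Mᵀ)) = M
    rw [expProdDeriv_toList_apply, hc, hτ, transpose_smul, transpose_add, transpose_transpose]
    module
  let φ := f'.nonlinearRightInverseOfSurjective hsurj
  have hφ : 0 < φ.nnnorm := f'.nonlinearRightInverseOfSurjective_nnnorm_pos hsurj
  have hcpos : 0 < φ.nnnorm⁻¹ / 2 := by positivity
  obtain ⟨s, hs0, hs⟩ := hf.approximates_deriv_on_nhds (Or.inr hcpos)
  obtain ⟨O, hOs, hO, h0O⟩ := mem_nhds_iff.1 hs0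
  -- The origin itself is left out: only positive times are admissible, and the map is open on every
  -- open subset of the neighbourhood `O`.
  let W : Set ((ι → ℝ) × Matrix (Fin n) (Fin n) ℝ) :=
    O ∩ ((⋂ k, {p | 0 < p.1 k}) ∩ {p | ‖τ p.2‖ < 1})
  have hWO : IsOpen W := by
    refine hO.inter (IsOpen.inter (isOpen_iInter_of_finite fun k => ?_) ?_)
    · exact isOpen_lt continuous_const ((continuous_apply k).comp continuous_fst)
    · exact isOpen_lt (τ.continuous.comp continuous_snd).norm continuous_const
  have hopen : IsOpen (f '' W) :=
    (hs.mono_set (Set.inter_subset_left.trans hOs)).open_image φ hWO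
      (Or.inr (NNReal.half_lt_self (by positivity)))
  obtain ⟨δ, hδ, hδO⟩ : ∃ δ : ℝ, 0 < δ ∧ ((fun _ => δ : ι → ℝ), 0) ∈ O := by
    have hc : Continuous fun δ : ℝ =>
        (((fun _ => δ : ι → ℝ), 0) : (ι → ℝ) × Matrix (Fin n) (Fin n) ℝ) := by fun_prop
    have h1 : ∀ᶠ δ in nhds (0 : ℝ),
        (((fun _ => δ : ι → ℝ), 0) : (ι → ℝ) × Matrix (Fin n) (Fin n) ℝ) ∈ O :=
      hc.continuousAt.eventually_mem (hO.mem_nhds h0O)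
    have h2 := (h1.filter_mono nhdsWithin_le_nhds).and
      (self_mem_nhdsWithin : Set.Ioi (0 : ℝ) ∈ nhdsWithin 0 (Set.Ioi 0))
    obtain ⟨δ, h, h'⟩ := h2.exists
    exact ⟨δ, h', h⟩
  obtain ⟨g₀, hg₀S, hg₀⟩ := hmem (fun _ => δ) fun _ => hδ.le
  refine ⟨g₀, mem_interior.2 ⟨Subtype.val ⁻¹' (f '' W), ?_,
    hopen.preimage continuous_subtype_val, ?_⟩⟩
  · rintro g ⟨p, hp, hpg⟩
    obtain ⟨h, hhS, hh⟩ := hmem p.1 fun k => (Set.mem_iInter.1 hp.2.1 k).le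
    have hlt : ‖τ p.2‖ < 1 := hp.2.2
    have hval : (h⁻¹ * g).1 = 1 + τ p.2 := by
      have : g.1 = h.1 * (1 + τ p.2) := by rw [hh, ← hpg]
      rw [Submonoid.coe_mul, this, ← mul_assoc, ← Submonoid.coe_mul, inv_mul_cancel,
        Submonoid.coe_one, one_mul]
    -- The factor is symmetric and, as a quotient of orthogonal matrices, orthogonal, so it is an
    -- involution. Expanding gives `2 τ = -τ²`, which forces `τ = 0` when the norm is below 1.
    have hsq : (1 + τ p.2) * (1 + τ p.2) = 1 := by
      have h1 := mem_unitaryGroup_iff.1 (h⁻¹ * g).2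
      rw [hval, star_eq_conjTranspose, conjTranspose_eq_transpose_of_trivial] at h1
      have h2 : (1 + τ p.2)ᵀ = 1 + τ p.2 := by
        rw [hτ, transpose_add, transpose_add, transpose_transpose, transpose_one, add_comm p.2]
      rwa [h2] at h1
    have hzero : τ p.2 = 0 := by
      have h1 : (2 : ℝ) • τ p.2 = -(τ p.2 * τ p.2) := by
        have h2 : (1 + τ p.2) * (1 + τ p.2) = 1 + ((2 : ℝ) • τ p.2 + τ p.2 * τ p.2) := by
          rw [two_smul]
          noncomm_ring
        rw [h2] at hsq
        exact eq_neg_of_add_eq_zero_left (by simpa using hsq)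
      have h3 := congrArg norm h1
      rw [norm_smul, norm_neg] at h3
      have h4 := norm_mul_le (τ p.2) (τ p.2)
      rw [← h3] at h4
      norm_num at h4
      rw [← norm_eq_zero]
      nlinarith [norm_nonneg (τ p.2)]
    have hg : g = h := by
      rw [hzero, add_zero] at hval
      exact (inv_mul_eq_one.1 (Subtype.ext hval)).symm
    rw [hg]
    exact hhS
  · refine ⟨((fun _ => δ), 0), ⟨hδO, Set.mem_iInter.2 fun _ => hδ, ?_⟩, ?_⟩
    · simp
    · simp [f, hg₀]

end Interior

/-- The criterion common to the three cases. For `n ≤ 1` the group is trivial; otherwise the values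
of `X` span `so(n)`, finitely many of them suffice, and the monoid of realizable left translations
contains `R₂ * R₁ᵀ`. -/
theorem liftControllable_of_signedPermConj {m : Type*} {n : ℕ} {K : Set (Matrix m m ℂ)}
    {X : Matrix m m ℂ → Matrix (Fin n) (Fin n) ℝ} (hK : K.Nonempty)
    (hskew : ∀ U ∈ K, (X U)ᵀ = -X U)
    (hconj : ∀ U ∈ K, ∀ π ε, ∃ V ∈ K, X V = signedPermConj π ε (X U))
    (hne : 2 ≤ n → ∃ U ∈ K, X U ≠ 0) : LiftControllable K X := by
  intro R₁ hR₁ R₂ hR₂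
  refine Steers.exists_mem_liftReach ?_
  rcases Nat.lt_or_ge n 2 with hn | hn
  · have : Subsingleton (Fin n) := Fin.subsingleton_iff_le_one.2 (by omega)
    have h1 : ∀ R ∈ specialOrthogonalGroup (Fin n) ℝ, R = 1 := by
      intro R hR
      have hdet := (mem_specialOrthogonalGroup_iff.1 hR).2
      ext i j
      rw [Subsingleton.elim j i, ← det_eq_elem_of_subsingleton R i, hdet, one_apply_eq]
    rw [h1 R₁ hR₁, h1 R₂ hR₂]
    exact Steers.refl hK (one_mem _)
  · obtain ⟨U₀, hU₀, hX₀⟩ := hne hn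
    let N := Submodule.span ℝ (X '' K)
    have hN : ∀ π ε, ∀ M ∈ N, signedPermConj π ε M ∈ N := by
      intro π ε M hM
      induction hM using Submodule.span_induction with
      | mem M h =>
        obtain ⟨U, hU, rfl⟩ := h
        obtain ⟨V, hV, hVX⟩ := hconj U hU π ε
        rw [← hVX]
        exact Submodule.subset_span ⟨V, hV, rfl⟩
      | zero =>
        convert N.zero_mem using 1
        ext i j
        simp [signedPermConj]
      | add M M' _ _ h h' =>
        convert N.add_mem h h' using 1
        ext i j
        simp [signedPermConj, mul_add]
      | smul c M _ h =>
        convert N.smul_mem c h using 1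
        ext i j
        simp [signedPermConj]
        ring
    obtain ⟨s, hsK, hspan⟩ := Submodule.fg_span_iff_fg_span_finset_subset (R := ℝ) (X '' K) |>.1
      (IsNoetherian.noetherian _)
    have hs : ∀ k : s, ∃ U ∈ K, X U = k.1 := fun k => hsK k.2
    choose u huK hu using hs
    let S : Submonoid (unitaryGroup (Fin n) ℝ) :=
      { carrier := {g | ∀ R ∈ specialOrthogonalGroup (Fin n) ℝ,
          g.1 * R ∈ specialOrthogonalGroup (Fin n) ℝ ∧ Steers K X R (g.1 * R)}
        one_mem' := fun R hR => by
          rw [Submonoid.coe_one, one_mul]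
          exact ⟨hR, Steers.refl hK hR⟩
        mul_mem' := fun {g h} hg hh R hR => by
          rw [Submonoid.coe_mul, mul_assoc]
          exact ⟨(hg _ (hh R hR).1).1, (hh R hR).2.trans (hg _ (hh R hR).1).2⟩ }
    have hexp : ∀ k : s, ∀ t : ℝ, 0 ≤ t → ∀ g : unitaryGroup (Fin n) ℝ,
        g.1 = NormedSpace.exp (t • -X (u k)) → g ∈ S := by
      intro k t ht g hg R hR
      rw [hg]
      refine ⟨mul_mem (exp_mem_specialOrthogonalGroup ?_) hR,
        Steers.exp (huK k) (hskew _ (huK k)) ht hR⟩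
      rw [transpose_smul, transpose_neg, hskew _ (huK k), smul_neg]
    have hint := interior_nonempty_of_exp_mem (fun k : s => -X (u k))
      (fun k => by rw [transpose_neg, hskew _ (huK k)]) (fun M hM => by
        have hMN := mem_of_signedPermConj_stable N hN (Submodule.subset_span ⟨U₀, hU₀, rfl⟩)
          (hskew U₀ hU₀) hX₀ hM
        change M ∈ Submodule.span ℝ (X '' K) at hMN
        rw [hspan, Submodule.mem_span_finset'] at hMN
        obtain ⟨c, hc⟩ := hMN
        refine ⟨fun k => -c k, ?_⟩
        simpa [hu] using hc) S hexp
    have hO : R₂ * R₁ᵀ ∈ unitaryGroup (Fin n) ℝ := by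
      rw [mem_unitaryGroup_iff, star_eq_conjTranspose, conjTranspose_eq_transpose_of_trivial,
        transpose_mul, transpose_transpose, mul_assoc, ← mul_assoc R₁ᵀ,
        mul_eq_one_comm.1 (mul_transpose_of_mem_specialOrthogonalGroup hR₁), one_mul,
        mul_transpose_of_mem_specialOrthogonalGroup hR₂]
    have hS := mem_submonoid_of_det_eq_one hn S hint ⟨R₂ * R₁ᵀ, hO⟩ (by
      rw [det_mul, det_transpose, (mem_specialOrthogonalGroup_iff.1 hR₁).2,
        (mem_specialOrthogonalGroup_iff.1 hR₂).2, one_mul])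
    have := (hS R₁ hR₁).2
    rwa [mul_assoc, mul_eq_one_comm.1 (mul_transpose_of_mem_specialOrthogonalGroup hR₁),
      mul_one] at this

/-! ### Matrix elements of a Hamiltonian between product states -/

section ProductForm

variable {d₁ d₂ : ℕ} (H : Matrix (Fin d₁ × Fin d₂) (Fin d₁ × Fin d₂) ℂ)

/-- The product state `v ⊗ w`. -/
def productState (v : Fin d₁ → ℂ) (w : Fin d₂ → ℂ) : Fin d₁ × Fin d₂ → ℂ :=
  fun p => v p.1 * w p.2

/-- The matrix element `⟨v ⊗ w| H |x ⊗ y⟩`. -/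
def productForm (v : Fin d₁ → ℂ) (w : Fin d₂ → ℂ) (x : Fin d₁ → ℂ) (y : Fin d₂ → ℂ) : ℂ :=
  star (productState v w) ⬝ᵥ (H *ᵥ productState x y)

theorem productState_add_left (v v' : Fin d₁ → ℂ) (w : Fin d₂ → ℂ) :
    productState (v + v') w = productState v w + productState v' w := by
  ext p
  simp [productState, add_mul]

theorem productState_add_right (v : Fin d₁ → ℂ) (w w' : Fin d₂ → ℂ) :
    productState v (w + w') = productState v w + productState v w' := by
  ext p
  simp [productState, mul_add]

theorem productState_smul_left (c : ℂ) (v : Fin d₁ → ℂ) (w : Fin d₂ → ℂ) :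
    productState (c • v) w = c • productState v w := by
  ext p
  simp [productState, mul_assoc]

theorem productState_smul_right (c : ℂ) (v : Fin d₁ → ℂ) (w : Fin d₂ → ℂ) :
    productState v (c • w) = c • productState v w := by
  ext p
  simp [productState, mul_left_comm]

theorem productState_single (a : Fin d₁) (b : Fin d₂) :
    productState (Pi.single a 1) (Pi.single b 1) = ket a b := by
  ext ⟨i, j⟩
  simp only [productState, ket, Pi.single_apply, Prod.mk.injEq]
  split_ifs <;> simp_all

variable (v v' : Fin d₁ → ℂ) (w w' : Fin d₂ → ℂ) (x x' : Fin d₁ → ℂ) (y y' : Fin d₂ → ℂ) (c : ℂ)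

theorem productForm_add_1 :
    productForm H (v + v') w x y = productForm H v w x y + productForm H v' w x y := by
  simp [productForm, productState_add_left, add_dotProduct]

theorem productForm_add_2 :
    productForm H v (w + w') x y = productForm H v w x y + productForm H v w' x y := by
  simp [productForm, productState_add_right, add_dotProduct]

theorem productForm_add_3 :
    productForm H v w (x + x') y = productForm H v w x y + productForm H v w x' y := by
  simp [productForm, productState_add_left, mulVec_add]

theorem productForm_add_4 :
    productForm H v w x (y + y') = productForm H v w x y + productForm H v w x y' := by
  simp [productForm, productState_add_right, mulVec_add]

theorem productForm_smul_1 : productForm H (c • v) w x y = star c * productForm H v w x y := by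
  simp [productForm, productState_smul_left]

theorem productForm_smul_2 : productForm H v (c • w) x y = star c * productForm H v w x y := by
  simp [productForm, productState_smul_right]

theorem productForm_smul_3 : productForm H v w (c • x) y = c * productForm H v w x y := by
  simp [productForm, productState_smul_left, mulVec_smul]

theorem productForm_smul_4 : productForm H v w x (c • y) = c * productForm H v w x y := by
  simp [productForm, productState_smul_right, mulVec_smul]

theorem productForm_single (a c : Fin d₁) (b d : Fin d₂) :
    productForm H (Pi.single a 1) (Pi.single b 1) (Pi.single c 1) (Pi.single d 1)
      = H (a, b) (c, d) := by
  simp only [productForm, productState_single, ket]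
  simp

variable {H}

theorem star_productForm (hH : H.IsHermitian) :
    star (productForm H v w x y) = productForm H x y v w := by
  have h := star_dotProduct (productState v w) (H *ᵥ productState x y)
  rw [productForm, h, star_star, ← hH.eq, productForm, star_mulVec, hH.eq, hH.eq,
    ← dotProduct_mulVec]

end ProductForm

theorem IsSymHamiltonian.apply_swap {d : ℕ} {H : Matrix (Fin d × Fin d) (Fin d × Fin d) ℂ}
    (hH : IsSymHamiltonian H) (p q : Fin d × Fin d) : H p.swap q.swap = H p q := by
  have hs : swapMatrix d = Matrix.of fun p q => if q = p.swap then 1 else 0 := by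
    ext p q
    have : p = q.swap ↔ q = p.swap := by
      rw [← Prod.swap_inj, Prod.swap_swap, eq_comm]
    simp [swapMatrix, this]
  conv_rhs => rw [← hH.2, hs]
  simp [Matrix.mul_apply]

theorem IsSymHamiltonian.productForm_swap {d : ℕ}
    {H : Matrix (Fin d × Fin d) (Fin d × Fin d) ℂ} (hH : IsSymHamiltonian H)
    (v w x y : Fin d → ℂ) : productForm H v w x y = productForm H w v y x := by
  simp only [productForm, dotProduct, mulVec, productState, Pi.star_apply]
  refine Fintype.sum_equiv (Equiv.prodComm _ _) _ _ fun p => ?_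
  rw [Equiv.prodComm_apply, Prod.fst_swap, Prod.snd_swap, mul_comm (v p.1)]
  congr 1
  refine Fintype.sum_equiv (Equiv.prodComm _ _) _ _ fun q => ?_
  rw [Equiv.prodComm_apply, Prod.fst_swap, Prod.snd_swap, mul_comm (x q.1), hH.apply_swap]

/-! ### Unitary matrices with prescribed columns -/

theorem exists_mem_unitaryGroup_col {κ : Type*} [DecidableEq κ] {d : ℕ} {e : κ → Fin d}
    (he : Function.Injective e) {v : κ → Fin d → ℂ}
    (hv : ∀ k l, star (v k) ⬝ᵥ v l = if k = l then 1 else 0) :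
    ∃ V ∈ unitaryGroup (Fin d) ℂ, ∀ k, Vᵀ (e k) = v k := by
  -- The default 0 outside the range of `e` is irrelevant: the orthonormal basis agrees with `v'`
  -- only on that range.
  let v' : Fin d → EuclideanSpace ℂ (Fin d) := Function.extend e (fun k => WithLp.toLp 2 (v k)) 0
  have hv' : ∀ k, v' (e k) = WithLp.toLp 2 (v k) := fun k => he.extend_apply _ _ _
  have ho : Orthonormal ℂ ((Set.range e).domRestrict v') := by
    rw [orthonormal_iff_ite]
    rintro ⟨_, k, rfl⟩ ⟨_, l, rfl⟩
    simp only [Set.domRestrict_apply, hv']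
    rw [EuclideanSpace.inner_toLp_toLp, dotProduct_comm]
    refine (hv k l).trans (if_congr ⟨fun h => ?_, fun h => he (congrArg Subtype.val h)⟩ rfl rfl)
    subst h
    rfl
  obtain ⟨b, hb⟩ := ho.exists_orthonormalBasis_extension_of_card_eq (by simp)
  refine ⟨Matrix.of fun a i => b i a, ?_, fun k => ?_⟩
  · rw [mem_unitaryGroup_iff']
    ext i j
    have := orthonormal_iff_ite.1 b.orthonormal i j
    rw [PiLp.inner_apply] at this
    rw [star_eq_conjTranspose, Matrix.mul_apply, Matrix.one_apply, ← this]
    refine Finset.sum_congr rfl fun a _ => ?_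
    simp [mul_comm]
  · ext a
    change b (e k) a = v k a
    rw [hb _ ⟨k, rfl⟩, hv']

theorem star_transpose_dotProduct_of_mem_unitaryGroup {d : ℕ} {V : Matrix (Fin d) (Fin d) ℂ}
    (hV : V ∈ unitaryGroup (Fin d) ℂ) (i j : Fin d) :
    star (Vᵀ i) ⬝ᵥ Vᵀ j = if i = j then 1 else 0 := by
  have := congrFun₂ (mem_unitaryGroup_iff'.1 hV) i j
  rw [Matrix.one_apply] at this
  rw [← this, star_eq_conjTranspose, Matrix.mul_apply]
  rfl

theorem exists_mem_unitaryGroup_col_smul {κ : Type*} [DecidableEq κ] {d : ℕ} {e : κ → Fin d}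
    (he : Function.Injective e) {v : κ → Fin d → ℂ} (hv0 : ∀ k, v k ≠ 0)
    (hv : ∀ k l, k ≠ l → star (v k) ⬝ᵥ v l = 0) :
    ∃ V ∈ unitaryGroup (Fin d) ℂ, ∃ c : κ → ℝ, (∀ k, 0 < c k) ∧
      ∀ k, Vᵀ (e k) = (c k : ℂ) • v k := by
  let r : κ → ℝ := fun k => ∑ a, ‖v k a‖ ^ 2
  have hr : ∀ k, star (v k) ⬝ᵥ v k = (r k : ℂ) := by
    intro k
    simp only [dotProduct, r, Pi.star_apply, Complex.ofReal_sum, Complex.ofReal_pow]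
    exact Finset.sum_congr rfl fun a _ => Complex.conj_mul' _
  have hpos : ∀ k, 0 < r k := by
    intro k
    obtain ⟨a, ha⟩ := Function.ne_iff.1 (hv0 k)
    exact Finset.sum_pos' (fun _ _ => by positivity)
      ⟨a, Finset.mem_univ a, pow_pos (norm_pos_iff.2 ha) 2⟩
  obtain ⟨V, hV, hVc⟩ := exists_mem_unitaryGroup_col he
    (v := fun k => (((Real.sqrt (r k))⁻¹ : ℝ) : ℂ) • v k) (fun k l => by
      rw [star_smul, smul_dotProduct, dotProduct_smul]
      split_ifs with h
      · subst h
        have h1 : (Real.sqrt (r k))⁻¹ * ((Real.sqrt (r k))⁻¹ * r k) = 1 := by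
          rw [← mul_assoc, ← mul_inv, Real.mul_self_sqrt (hpos k).le,
            inv_mul_cancel₀ (hpos k).ne']
        rw [hr, RCLike.star_def, Complex.conj_ofReal, smul_eq_mul, smul_eq_mul]
        exact_mod_cast h1
      · rw [hv k l h, smul_zero, smul_zero])
  exact ⟨V, hV, fun k => (Real.sqrt (r k))⁻¹, fun k => inv_pos.2 (Real.sqrt_pos.2 (hpos k)), hVc⟩

/-! ### The induced vector fields as matrix elements -/

theorem conjTranspose_mul_mul_apply {m : Type*} [Fintype m] (H U : Matrix m m ℂ) (p q : m) :
    (Uᴴ * (Complex.I • H) * U) p q = Complex.I * (star (Uᵀ p) ⬝ᵥ (H *ᵥ Uᵀ q)) := by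
  rw [Matrix.mul_smul, Matrix.smul_mul, Matrix.smul_apply, smul_eq_mul, Matrix.mul_assoc,
    Matrix.mul_apply]
  rfl

theorem diagState_single {d₁ d₂ : ℕ} (j : Fin (min d₁ d₂)) :
    diagState d₁ d₂ (Pi.single j 1)
      = ket (Fin.castLE (min_le_left d₁ d₂) j) (Fin.castLE (min_le_right d₁ d₂) j) := by
  change ∑ i, ((Pi.single j 1 : Fin (min d₁ d₂) → ℝ) i : ℂ) • _ = _
  rw [Finset.sum_eq_single j (fun i _ h => by simp [h]) (by simp)]
  simp

theorem diagStateSym_single {d : ℕ} (j : Fin d) :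
    diagStateSym d (Pi.single j 1) = ket j j := by
  change ∑ i, ((Pi.single j 1 : Fin d → ℝ) i : ℂ) • _ = _
  rw [Finset.sum_eq_single j (fun i _ h => by simp [h]) (by simp)]
  simp

theorem qdiagState_single {d : ℕ} (j : Fin (d / 2)) :
    qdiagState d (Pi.single j 1) = ((1 / Real.sqrt 2 : ℝ) : ℂ) •
      (ket (oddIdx j) (evenIdx j) - ket (evenIdx j) (oddIdx j)) := by
  change (_ : ℂ) • ∑ i, ((Pi.single j 1 : Fin (d / 2) → ℝ) i : ℂ) •
    (ket (oddIdx i) (evenIdx i) - ket (evenIdx i) (oddIdx i)) = _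
  rw [Finset.sum_eq_single j (fun i _ h => by simp [h]) (by simp)]
  simp

theorem inducedField_apply {m : Type*} [Fintype m] [DecidableEq m] {n : ℕ}
    (D : (Fin n → ℝ) →ₗ[ℝ] (m → ℂ)) (P : (m → ℂ) →ₗ[ℝ] (Fin n → ℝ)) (H U : Matrix m m ℂ)
    (i j : Fin n) :
    inducedField D P H U i j = P ((Uᴴ * (Complex.I • H) * U) *ᵥ D (Pi.single j 1)) i := by
  rw [inducedField, LinearMap.toMatrix'_apply]
  rfl

theorem inducedDist_kronecker_apply {d₁ d₂ : ℕ}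
    (H : Matrix (Fin d₁ × Fin d₂) (Fin d₁ × Fin d₂) ℂ) (V : Matrix (Fin d₁) (Fin d₁) ℂ)
    (W : Matrix (Fin d₂) (Fin d₂) ℂ) (i j : Fin (min d₁ d₂)) :
    inducedDist H (V ⊗ₖ W) i j = -(productForm H
      (Vᵀ (Fin.castLE (min_le_left d₁ d₂) i)) (Wᵀ (Fin.castLE (min_le_right d₁ d₂) i))
      (Vᵀ (Fin.castLE (min_le_left d₁ d₂) j)) (Wᵀ (Fin.castLE (min_le_right d₁ d₂) j))).im := by
  rw [inducedDist, inducedField_apply, diagState_single, ket, mulVec_single_one]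
  change (((V ⊗ₖ W)ᴴ * (Complex.I • H) * (V ⊗ₖ W)) _ _).re = _
  rw [conjTranspose_mul_mul_apply, Complex.I_mul_re]
  rfl

theorem inducedBos_kronecker_apply {d : ℕ} (H : Matrix (Fin d × Fin d) (Fin d × Fin d) ℂ)
    (V : Matrix (Fin d) (Fin d) ℂ) (i j : Fin d) :
    inducedBos H (V ⊗ₖ V) i j = -(productForm H (Vᵀ i) (Vᵀ i) (Vᵀ j) (Vᵀ j)).im := by
  rw [inducedBos, inducedField_apply, diagStateSym_single, ket, mulVec_single_one]
  change (((V ⊗ₖ V)ᴴ * (Complex.I • H) * (V ⊗ₖ V)) _ _).re = _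
  rw [conjTranspose_mul_mul_apply, Complex.I_mul_re]
  rfl

/-- The matrix element of `H` between `v ⊗ w` and `x ⊗ y - y ⊗ x`. -/
def altForm {d : ℕ} (H : Matrix (Fin d × Fin d) (Fin d × Fin d) ℂ) (v w x y : Fin d → ℂ) : ℂ :=
  productForm H v w x y - productForm H v w y x

theorem inducedFer_kronecker_apply {d : ℕ} (H : Matrix (Fin d × Fin d) (Fin d × Fin d) ℂ)
    (V : Matrix (Fin d) (Fin d) ℂ) (i j : Fin (d / 2)) :
    inducedFer H (V ⊗ₖ V) i j = -(altForm H (Vᵀ (oddIdx i)) (Vᵀ (evenIdx i))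
      (Vᵀ (oddIdx j)) (Vᵀ (evenIdx j))).im := by
  rw [inducedFer, inducedField_apply, qdiagState_single, mulVec_smul, mulVec_sub, ket, ket,
    mulVec_single_one, mulVec_single_one]
  change Real.sqrt 2 * (((1 / Real.sqrt 2 : ℝ) : ℂ) *
    (((V ⊗ₖ V)ᴴ * (Complex.I • H) * (V ⊗ₖ V)) _ _ -
      ((V ⊗ₖ V)ᴴ * (Complex.I • H) * (V ⊗ₖ V)) _ _)).re = _
  rw [conjTranspose_mul_mul_apply, conjTranspose_mul_mul_apply, ← mul_sub, Complex.re_ofReal_mul,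
    Complex.I_mul_re, ← mul_assoc, mul_one_div_cancel (by positivity), one_mul]
  rfl

theorem productForm_sub_3 {d₁ d₂ : ℕ} (H : Matrix (Fin d₁ × Fin d₂) (Fin d₁ × Fin d₂) ℂ)
    (v x x' : Fin d₁ → ℂ) (w y : Fin d₂ → ℂ) :
    productForm H v w (x - x') y = productForm H v w x y - productForm H v w x' y := by
  rw [sub_eq_add_neg, ← neg_one_smul ℂ x', productForm_add_3, productForm_smul_3]
  ring

theorem productForm_sub_4 {d₁ d₂ : ℕ} (H : Matrix (Fin d₁ × Fin d₂) (Fin d₁ × Fin d₂) ℂ)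
    (v x : Fin d₁ → ℂ) (w y y' : Fin d₂ → ℂ) :
    productForm H v w x (y - y') = productForm H v w x y - productForm H v w x y' := by
  rw [sub_eq_add_neg, ← neg_one_smul ℂ y', productForm_add_4, productForm_smul_4]
  ring

theorem star_single_dotProduct_single {d : ℕ} {i j : Fin d} (h : i ≠ j) :
    star (Pi.single i 1 : Fin d → ℂ) ⬝ᵥ Pi.single j 1 = 0 := by
  simp [h]

theorem star_single_add_dotProduct_single_sub {d : ℕ} {i j : Fin d} (h : i ≠ j) :
    star (Pi.single i 1 + Pi.single j 1 : Fin d → ℂ) ⬝ᵥ (Pi.single i 1 - Pi.single j 1) = 0 := by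
  simp [h, h.symm]

/-- Two orthogonal vectors are, up to positive factors, prescribed columns of a unitary matrix. -/
theorem exists_mem_unitaryGroup_two_col {d : ℕ} {i j : Fin d} (hij : i ≠ j) {v w : Fin d → ℂ}
    (hv : v ≠ 0) (hw : w ≠ 0) (h : star v ⬝ᵥ w = 0) :
    ∃ V ∈ unitaryGroup (Fin d) ℂ, ∃ a b : ℝ, 0 < a ∧ 0 < b ∧
      Vᵀ i = (a : ℂ) • v ∧ Vᵀ j = (b : ℂ) • w := by
  have h' : star w ⬝ᵥ v = 0 := by
    rw [star_dotProduct, h, star_zero]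
  obtain ⟨V, hV, c, hc, hVc⟩ := exists_mem_unitaryGroup_col_smul (e := ![i, j]) (v := ![v, w])
    (by intro k l hkl; fin_cases k <;> fin_cases l <;> simp_all [eq_comm])
    (by intro k; fin_cases k <;> simpa) (by
      intro k l hkl
      fin_cases k <;> fin_cases l <;> simp_all)
  exact ⟨V, hV, c 0, c 1, hc 0, hc 1, hVc 0, hVc 1⟩

/-- The embedding of the diagonal indices into the indices of the first subsystem. -/
abbrev leftIdx {d₁ d₂ : ℕ} (i : Fin (min d₁ d₂)) : Fin d₁ := Fin.castLE (min_le_left d₁ d₂) i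

/-- The embedding of the diagonal indices into the indices of the second subsystem. -/
abbrev rightIdx {d₁ d₂ : ℕ} (i : Fin (min d₁ d₂)) : Fin d₂ := Fin.castLE (min_le_right d₁ d₂) i

theorem units_star_mul {n : ℕ} (ε : Fin n → ℤˣ) (k : Fin n) :
    star (((ε k : ℤ) : ℂ)) * ((ε k : ℤ) : ℂ) = 1 := by
  rcases Int.units_eq_one_or (ε k) with h | h <;> simp [h]

/-- Permuting and rephasing orthonormal vectors gives orthonormal vectors. -/
theorem orthonormal_smul_comp {κ : Type*} [DecidableEq κ] {d : ℕ} {v : κ → Fin d → ℂ}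
    (hv : ∀ k l, star (v k) ⬝ᵥ v l = if k = l then 1 else 0) (π : Equiv.Perm κ) {c : κ → ℂ}
    (hc : ∀ k, star (c k) * c k = 1) (k l : κ) :
    star (c k • v (π k)) ⬝ᵥ (c l • v (π l)) = if k = l then 1 else 0 := by
  rw [star_smul, smul_dotProduct, dotProduct_smul, hv]
  by_cases h : k = l
  · subst h
    simpa using hc k
  · rw [if_neg (fun e => h (π.injective e)), if_neg h, smul_zero, smul_zero]

theorem orthonormal_col {κ : Type*} [DecidableEq κ] {d : ℕ} {V : Matrix (Fin d) (Fin d) ℂ}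
    (hV : V ∈ unitaryGroup (Fin d) ℂ) {e : κ → Fin d} (he : Function.Injective e) (k l : κ) :
    star (Vᵀ (e k)) ⬝ᵥ Vᵀ (e l) = if k = l then 1 else 0 := by
  rw [star_transpose_dotProduct_of_mem_unitaryGroup hV]
  exact if_congr he.eq_iff rfl rfl

/-! ### Distinguishable subsystems -/

section Distinguishable

variable {d₁ d₂ : ℕ} {H : Matrix (Fin d₁ × Fin d₂) (Fin d₁ × Fin d₂) ℂ}

theorem inducedDist_transpose (hH : H.IsHermitian) {U : Matrix (Fin d₁ × Fin d₂) (Fin d₁ × Fin d₂) ℂ}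
    (hU : U ∈ localUnitaries d₁ d₂) : (inducedDist H U)ᵀ = -inducedDist H U := by
  obtain ⟨V, -, W, -, rfl⟩ := hU
  ext i j
  rw [Matrix.transpose_apply, Matrix.neg_apply, inducedDist_kronecker_apply,
    inducedDist_kronecker_apply, ← star_productForm _ _ _ _ hH, RCLike.star_def, Complex.conj_im]

/-- The columns of both factors are permuted, but the signs go into the first factor only; on both
they would cancel. -/
theorem exists_inducedDist_eq_signedPermConj {U : Matrix (Fin d₁ × Fin d₂) (Fin d₁ × Fin d₂) ℂ}
    (hU : U ∈ localUnitaries d₁ d₂) (π : Equiv.Perm (Fin (min d₁ d₂)))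
    (ε : Fin (min d₁ d₂) → ℤˣ) :
    ∃ U' ∈ localUnitaries d₁ d₂, inducedDist H U' = signedPermConj π ε (inducedDist H U) := by
  obtain ⟨V, hV, W, hW, rfl⟩ := hU
  have hl : Function.Injective (leftIdx (d₁ := d₁) (d₂ := d₂)) := Fin.castLE_injective _
  have hr : Function.Injective (rightIdx (d₁ := d₁) (d₂ := d₂)) := Fin.castLE_injective _
  obtain ⟨V', hV', hVc⟩ := exists_mem_unitaryGroup_col hl
    (orthonormal_smul_comp (orthonormal_col hV hl) π (units_star_mul ε))
  obtain ⟨W', hW', hWc⟩ := exists_mem_unitaryGroup_col hr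
    (orthonormal_smul_comp (orthonormal_col hW hr) π (c := fun _ => 1) (by simp))
  refine ⟨V' ⊗ₖ W', ⟨V', hV', W', hW', rfl⟩, ?_⟩
  ext i j
  rw [signedPermConj, Matrix.of_apply, inducedDist_kronecker_apply, inducedDist_kronecker_apply,
    hVc, hVc, hWc, hWc]
  simp only [one_smul, productForm_smul_1, productForm_smul_3]
  rcases Int.units_eq_one_or (ε i) with h | h <;> rcases Int.units_eq_one_or (ε j) with h' | h' <;>
    simp [h, h']

/-- Orthogonal nonzero vectors are columns of unitaries up to positive factors, so the imaginary
part vanishes. Replacing `x` by `i x` disposes of the real part. -/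
theorem productForm_eq_zero_of_inducedDist_eq_zero (h₁ : 2 ≤ d₁) (h₂ : 2 ≤ d₂)
    (hX : ∀ U ∈ localUnitaries d₁ d₂, inducedDist H U = 0) {v x : Fin d₁ → ℂ} {w y : Fin d₂ → ℂ}
    (hvx : star v ⬝ᵥ x = 0) (hwy : star w ⬝ᵥ y = 0) : productForm H v w x y = 0 := by
  have him : ∀ {x : Fin d₁ → ℂ}, star v ⬝ᵥ x = 0 → (productForm H v w x y).im = 0 := by
    intro x hvx
    by_cases hv : v = 0
    · rw [hv, ← zero_smul ℂ (0 : Fin d₁ → ℂ), productForm_smul_1]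
      simp
    by_cases hx : x = 0
    · rw [hx, ← zero_smul ℂ (0 : Fin d₁ → ℂ), productForm_smul_3]
      simp
    by_cases hw : w = 0
    · rw [hw, ← zero_smul ℂ (0 : Fin d₂ → ℂ), productForm_smul_2]
      simp
    by_cases hy : y = 0
    · rw [hy, ← zero_smul ℂ (0 : Fin d₂ → ℂ), productForm_smul_4]
      simp
    let i : Fin (min d₁ d₂) := ⟨0, by omega⟩
    let j : Fin (min d₁ d₂) := ⟨1, by omega⟩
    obtain ⟨V, hV, a, b, ha, hb, hVi, hVj⟩ := exists_mem_unitaryGroup_two_col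
      (i := leftIdx i) (j := leftIdx j) (by simp [leftIdx, i, j, Fin.ext_iff]) hv hx hvx
    obtain ⟨W, hW, a', b', ha', hb', hWi, hWj⟩ := exists_mem_unitaryGroup_two_col
      (i := rightIdx i) (j := rightIdx j) (by simp [rightIdx, i, j, Fin.ext_iff]) hw hy hwy
    have h := congrFun₂ (hX _ ⟨V, hV, W, hW, rfl⟩) i j
    rw [inducedDist_kronecker_apply, hVi, hVj, hWi, hWj, productForm_smul_1, productForm_smul_2,
      productForm_smul_3, productForm_smul_4] at h
    simp only [RCLike.star_def, Complex.conj_ofReal, Complex.im_ofReal_mul, Matrix.zero_apply,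
      neg_eq_zero, mul_eq_zero, ha.ne', hb.ne', ha'.ne', hb'.ne', false_or] at h
    exact h
  refine Complex.ext ?_ (him hvx)
  have h := him (x := Complex.I • x) (by rw [dotProduct_smul, hvx, smul_zero])
  rwa [productForm_smul_3, Complex.I_mul_im] at h

/-- The orthogonal test pairs are `e_i, e_j` and `e_i + e_j, e_i - e_j` in each factor. They show
that entries changing both indices vanish, that entries changing one index do not depend on the
other, and that the diagonal is additive. -/
theorem isLocal_of_productForm_eq_zero (h₁ : 0 < d₁) (h₂ : 0 < d₂) (hH : H.IsHermitian)
    (h : ∀ v w x y, star v ⬝ᵥ x = 0 → star w ⬝ᵥ y = 0 → productForm H v w x y = 0) :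
    IsLocal H := by
  have r1 : ∀ {i j k l}, i ≠ j → k ≠ l → H (i, k) (j, l) = 0 := by
    intro i j k l hij hkl
    have := h _ _ _ _ (star_single_dotProduct_single hij) (star_single_dotProduct_single hkl)
    rwa [productForm_single] at this
  have r2 : ∀ {i j k l}, i ≠ j → H (i, k) (j, k) = H (i, l) (j, l) := by
    intro i j k l hij
    rcases eq_or_ne k l with rfl | hkl
    · rfl
    have := h _ _ _ _ (star_single_dotProduct_single hij)
      (star_single_add_dotProduct_single_sub hkl)
    simp only [productForm_add_2, productForm_sub_4, productForm_single] at this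
    linear_combination this + r1 hij hkl - r1 hij hkl.symm
  have r3 : ∀ {i j k l}, k ≠ l → H (i, k) (i, l) = H (j, k) (j, l) := by
    intro i j k l hkl
    rcases eq_or_ne i j with rfl | hij
    · rfl
    have := h _ _ _ _ (star_single_add_dotProduct_single_sub hij)
      (star_single_dotProduct_single hkl)
    simp only [productForm_add_1, productForm_sub_3, productForm_single] at this
    linear_combination this + r1 hij hkl - r1 hij.symm hkl
  have r4 : ∀ i j k l, H (i, k) (i, k) - H (i, l) (i, l) - H (j, k) (j, k) + H (j, l) (j, l) = 0 := by
    intro i j k l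
    rcases eq_or_ne i j with rfl | hij
    · ring
    rcases eq_or_ne k l with rfl | hkl
    · ring
    have := h _ _ _ _ (star_single_add_dotProduct_single_sub hij)
      (star_single_add_dotProduct_single_sub hkl)
    simp only [productForm_add_1, productForm_add_2, productForm_sub_3, productForm_sub_4,
      productForm_single] at this
    linear_combination this + r3 (i := i) (j := j) hkl - r3 (i := i) (j := j) hkl.symm
      + r2 (k := k) (l := l) hij - r2 (k := k) (l := l) hij.symm - r1 hij hkl - r1 hij.symm hkl.symm
      + r1 hij hkl.symm + r1 hij.symm hkl
  let o₁ : Fin d₁ := ⟨0, h₁⟩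
  let o₂ : Fin d₂ := ⟨0, h₂⟩
  -- The constant `H (o₁, o₂) (o₁, o₂)` is already counted in `E`, so it is removed from the
  -- diagonal of `F`.
  refine ⟨Matrix.of fun i j => H (i, o₂) (j, o₂),
    Matrix.of fun k l => H (o₁, k) (o₁, l) - if k = l then H (o₁, o₂) (o₁, o₂) else 0, ?_, ?_, ?_⟩
  · ext i j
    exact hH.apply _ _
  · ext k l
    simp only [conjTranspose_apply, Matrix.of_apply, star_sub, hH.apply, eq_comm (a := l)]
    split_ifs
    · rw [hH.apply]
    · rw [star_zero]
  · ext ⟨i, k⟩ ⟨j, l⟩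
    simp only [Matrix.add_apply, kroneckerMap_apply, Matrix.of_apply, Matrix.one_apply]
    rcases eq_or_ne i j with rfl | hij <;> rcases eq_or_ne k l with rfl | hkl
    · simp only [if_true]
      linear_combination r4 i o₁ k o₂
    · simp only [if_true, if_neg hkl]
      linear_combination r3 (i := i) (j := o₁) hkl
    · simp only [if_true, if_neg hij]
      linear_combination r2 (k := k) (l := o₂) hij
    · simp only [if_neg hkl, if_neg hij]
      linear_combination r1 hij hkl

theorem liftControllable_inducedDist (h₁ : 2 ≤ d₁) (h₂ : 2 ≤ d₂) (hH : H.IsHermitian)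
    (hloc : ¬ IsLocal H) : LiftControllable (localUnitaries d₁ d₂) (inducedDist H) := by
  refine liftControllable_of_signedPermConj ⟨_, 1, one_mem _, 1, one_mem _, rfl⟩
    (fun U hU => inducedDist_transpose hH hU)
    (fun U hU π ε => exists_inducedDist_eq_signedPermConj hU π ε) fun _ => ?_
  by_contra! hX
  exact hloc (isLocal_of_productForm_eq_zero (by omega) (by omega) hH fun v w x y hvx hwy =>
    productForm_eq_zero_of_inducedDist_eq_zero h₁ h₂ hX hvx hwy)

end Distinguishable

/-! ### Indistinguishable subsystems -/

theorem swapMatrix_mulVec {d : ℕ} (ψ : Fin d × Fin d → ℂ) (p : Fin d × Fin d) :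
    (swapMatrix d *ᵥ ψ) p = ψ p.swap := by
  have h : ∀ q : Fin d × Fin d, p = q.swap ↔ q = p.swap := by
    intro q
    rw [← Prod.swap_inj, Prod.swap_swap, eq_comm]
  simp [swapMatrix, mulVec, dotProduct, h]

/-- On (anti)symmetric states only the (anti)symmetrized matrix elements matter. -/
theorem mulVec_eq_of_add_swap_eq {d : ℕ} {H L : Matrix (Fin d × Fin d) (Fin d × Fin d) ℂ} {s : ℂ}
    {ψ : Fin d × Fin d → ℂ} (hψ : ∀ q, ψ q.swap = s * ψ q)
    (h : ∀ p q, H p q + s * H p q.swap = L p q + s * L p q.swap) : H *ᵥ ψ = L *ᵥ ψ := by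
  have key : ∀ (M : Matrix (Fin d × Fin d) (Fin d × Fin d) ℂ) (p : Fin d × Fin d),
      2 * (M *ᵥ ψ) p = ∑ q, (M p q + s * M p q.swap) * ψ q := by
    intro M p
    have h1 : (M *ᵥ ψ) p = ∑ q : Fin d × Fin d, M p q.swap * ψ q.swap :=
      Fintype.sum_equiv (Equiv.prodComm _ _) _ _ fun q => by simp
    rw [two_mul]
    nth_rw 2 [h1]
    rw [mulVec, dotProduct, ← Finset.sum_add_distrib]
    refine Finset.sum_congr rfl fun q _ => ?_
    rw [hψ]
    ring
  ext p
  refine mul_left_cancel₀ (two_ne_zero' ℂ) ?_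
  rw [key, key]
  exact Finset.sum_congr rfl fun q _ => by rw [h]

/-- A square root of the sign `ε k`. -/
noncomputable def signRoot {n : ℕ} (ε : Fin n → ℤˣ) (k : Fin n) : ℂ :=
  if ε k = 1 then 1 else Complex.I

theorem star_signRoot_mul {n : ℕ} (ε : Fin n → ℤˣ) (k : Fin n) :
    star (signRoot ε k) * signRoot ε k = 1 := by
  unfold signRoot
  split_ifs <;> simp

theorem star_signRoot_mul_star {n : ℕ} (ε : Fin n → ℤˣ) (k : Fin n) :
    star (signRoot ε k) * star (signRoot ε k) = ((ε k : ℤ) : ℂ) := by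
  unfold signRoot
  rcases Int.units_eq_one_or (ε k) with h | h <;> simp [h]

theorem signRoot_mul_self {n : ℕ} (ε : Fin n → ℤˣ) (k : Fin n) :
    signRoot ε k * signRoot ε k = ((ε k : ℤ) : ℂ) := by
  unfold signRoot
  rcases Int.units_eq_one_or (ε k) with h | h <;> simp [h]

/-! ### Bosons -/

section Bosons

variable {d : ℕ} {H : Matrix (Fin d × Fin d) (Fin d × Fin d) ℂ}

theorem inducedBos_transpose (hH : H.IsHermitian) {U : Matrix (Fin d × Fin d) (Fin d × Fin d) ℂ}
    (hU : U ∈ symLocalUnitaries d) : (inducedBos H U)ᵀ = -inducedBos H U := by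
  obtain ⟨V, -, rfl⟩ := hU
  ext i j
  rw [Matrix.transpose_apply, Matrix.neg_apply, inducedBos_kronecker_apply,
    inducedBos_kronecker_apply, ← star_productForm _ _ _ _ hH, RCLike.star_def, Complex.conj_im]

/-- Each column enters `v ⊗ v` twice, so a sign is produced by rephasing with its square root, 1 or
`i`. -/
theorem exists_inducedBos_eq_signedPermConj {U : Matrix (Fin d × Fin d) (Fin d × Fin d) ℂ}
    (hU : U ∈ symLocalUnitaries d) (π : Equiv.Perm (Fin d)) (ε : Fin d → ℤˣ) :
    ∃ U' ∈ symLocalUnitaries d, inducedBos H U' = signedPermConj π ε (inducedBos H U) := by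
  obtain ⟨V, hV, rfl⟩ := hU
  obtain ⟨V', hV', hVc⟩ := exists_mem_unitaryGroup_col Function.injective_id
    (orthonormal_smul_comp (orthonormal_col hV Function.injective_id) π (star_signRoot_mul ε))
  refine ⟨V' ⊗ₖ V', ⟨V', hV', rfl⟩, ?_⟩
  ext i j
  have hc : ∀ k, V'ᵀ k = signRoot ε k • Vᵀ (π k) := hVc
  rw [signedPermConj, Matrix.of_apply, inducedBos_kronecker_apply, inducedBos_kronecker_apply,
    hc, hc]
  simp only [productForm_smul_1, productForm_smul_2, productForm_smul_3, productForm_smul_4]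
  rw [← mul_assoc, signRoot_mul_self, ← mul_assoc (star _), star_signRoot_mul_star]
  rcases Int.units_eq_one_or (ε i) with h | h <;> rcases Int.units_eq_one_or (ε j) with h' | h' <;>
    simp [h, h']

/-- The form is quadratic in `x`; the factor `1 + i`, whose square is `2 i`, exchanges real and
imaginary parts. -/
theorem productForm_self_eq_zero_of_inducedBos_eq_zero (hd : 2 ≤ d)
    (hX : ∀ U ∈ symLocalUnitaries d, inducedBos H U = 0) {v x : Fin d → ℂ}
    (hvx : star v ⬝ᵥ x = 0) : productForm H v v x x = 0 := by
  have him : ∀ {x : Fin d → ℂ}, star v ⬝ᵥ x = 0 → (productForm H v v x x).im = 0 := by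
    intro x hvx
    by_cases hv : v = 0
    · rw [hv, ← zero_smul ℂ (0 : Fin d → ℂ), productForm_smul_1]
      simp
    by_cases hx : x = 0
    · rw [hx, ← zero_smul ℂ (0 : Fin d → ℂ), productForm_smul_3]
      simp
    let i : Fin d := ⟨0, by omega⟩
    let j : Fin d := ⟨1, by omega⟩
    obtain ⟨V, hV, a, b, ha, hb, hVi, hVj⟩ := exists_mem_unitaryGroup_two_col
      (i := i) (j := j) (by simp [i, j]) hv hx hvx
    have h := congrFun₂ (hX _ ⟨V, hV, rfl⟩) i j
    rw [inducedBos_kronecker_apply, hVi, hVj, productForm_smul_1, productForm_smul_2,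
      productForm_smul_3, productForm_smul_4] at h
    simp only [RCLike.star_def, Complex.conj_ofReal, Complex.im_ofReal_mul, Matrix.zero_apply,
      neg_eq_zero, mul_eq_zero, ha.ne', hb.ne', false_or] at h
    exact h
  refine Complex.ext ?_ (him hvx)
  have h := him (x := (1 + Complex.I) • x) (by rw [dotProduct_smul, hvx, smul_zero])
  rw [productForm_smul_3, productForm_smul_4, ← mul_assoc] at h
  have h2 : (1 + Complex.I) * (1 + Complex.I) = 2 * Complex.I := by
    linear_combination Complex.I_mul_I
  rw [h2, mul_assoc] at h
  simpa using h

/-- Polarization in `x` and then in `v` gives the relations among entries with at least three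
distinct indices. Those involving only two indices come from rotated pairs in a coordinate plane.
Only the symmetrized entries of `H` need to match a local operator. -/
theorem isLocalOn_bosonicSpace (hH : IsSymHamiltonian H)
    (h : ∀ v x, star v ⬝ᵥ x = 0 → productForm H v v x x = 0) :
    IsLocalOn (bosonicSpace d) H := by
  have hs := hH.productForm_swap
  have p1 : ∀ {v x y}, star v ⬝ᵥ x = 0 → star v ⬝ᵥ y = 0 → productForm H v v x y = 0 := by
    intro v x y hx hy
    have h1 := h v (x + y) (by rw [dotProduct_add, hx, hy, add_zero])
    simp only [productForm_add_3, productForm_add_4] at h1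
    linear_combination (1 / 2) * (h1 - h v x hx - h v y hy + hs v v x y)
  have p2 : ∀ {v w x y}, star v ⬝ᵥ x = 0 → star v ⬝ᵥ y = 0 → star w ⬝ᵥ x = 0 → star w ⬝ᵥ y = 0 →
      productForm H v w x y + productForm H v w y x = 0 := by
    intro v w x y hvx hvy hwx hwy
    have h1 := p1 (v := v + w) (x := x) (y := y) (by rw [star_add, add_dotProduct, hvx, hwx, add_zero])
      (by rw [star_add, add_dotProduct, hvy, hwy, add_zero])
    simp only [productForm_add_1, productForm_add_2] at h1
    linear_combination h1 - p1 hvx hvy - p1 hwx hwy + hs v w y x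
  have hsH : ∀ a b c e, H (a, b) (c, e) = H (b, a) (e, c) := fun a b c e =>
    (hH.apply_swap (b, a) (e, c))
  have o := fun {a b : Fin d} (hab : a ≠ b) => star_single_dotProduct_single hab
  have r1 : ∀ {a b c e}, a ≠ c → a ≠ e → b ≠ c → b ≠ e →
      H (a, b) (c, e) + H (a, b) (e, c) = 0 := by
    intro a b c e hac hae hbc hbe
    have := p2 (o hac) (o hae) (o hbc) (o hbe)
    simpa only [productForm_single] using this
  -- The two tests differ in the sign of `e_b`, so their sum retains only terms even in `e_b`; the
  -- one at `(b, b), (a, c)` vanishes by `r1`.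
  have r2 : ∀ {a b c}, a ≠ b → a ≠ c → b ≠ c →
      H (a, a) (a, c) = H (a, b) (b, c) + H (b, a) (b, c) := by
    intro a b c hab hac hbc
    have h1 := p1 (v := Pi.single a 1 + Pi.single b 1) (x := Pi.single a 1 - Pi.single b 1)
      (y := Pi.single c 1) (star_single_add_dotProduct_single_sub hab) (by
        rw [star_add, add_dotProduct, o hac, o hbc, add_zero])
    have h2 := p1 (v := Pi.single a 1 + (-1 : ℂ) • Pi.single b 1)
      (x := Pi.single a 1 + Pi.single b 1) (y := Pi.single c 1)
      (by simp [hab, hab.symm]) (by simp [hac, hbc])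
    simp only [productForm_add_1, productForm_add_2, productForm_add_3, productForm_sub_3,
      productForm_smul_1, productForm_smul_2, productForm_single, star_neg, star_one] at h1 h2
    linear_combination (1 / 2) * (h1 + h2) - (1 / 2) * r1 hab.symm hbc hab.symm hbc
      - (1 / 2) * hsH b b a c
  -- This is the test on `p e_a + q e_b` and `q e_a - p e_b`; the `p⁴` and `q⁴` terms vanish by
  -- `r1`. Three values of `(p, q)` then separate the coefficients.
  have quartic : ∀ {a b}, a ≠ b → ∀ p q : ℝ,
      (p : ℂ) ^ 3 * q * (H (a, b) (b, b) + H (b, a) (b, b) - H (a, a) (a, b) - H (a, a) (b, a))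
      + (p : ℂ) ^ 2 * q ^ 2 * (H (a, a) (a, a) + H (b, b) (b, b) - H (a, b) (a, b)
        - H (a, b) (b, a) - H (b, a) (a, b) - H (b, a) (b, a))
      + p * (q : ℂ) ^ 3 * (H (a, b) (a, a) + H (b, a) (a, a) - H (b, b) (a, b)
        - H (b, b) (b, a)) = 0 := by
    intro a b hab p q
    have h1 := h ((p : ℂ) • Pi.single a 1 + (q : ℂ) • Pi.single b 1)
      ((q : ℂ) • Pi.single a 1 + (-p : ℂ) • Pi.single b 1) (by
        simp [hab, hab.symm]
        ring)
    simp only [productForm_add_1, productForm_add_2, productForm_add_3, productForm_add_4,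
      productForm_smul_1, productForm_smul_2, productForm_smul_3, productForm_smul_4,
      productForm_single, RCLike.star_def, Complex.conj_ofReal] at h1
    linear_combination h1 - (1 / 2) * (p : ℂ) ^ 4 * r1 hab hab hab hab
      - (1 / 2) * (q : ℂ) ^ 4 * r1 hab.symm hab.symm hab.symm hab.symm
  have q1 := fun {a b : Fin d} (hab : a ≠ b) => quartic hab 1 1
  have q2 := fun {a b : Fin d} (hab : a ≠ b) => quartic hab 1 (-1)
  have q3 := fun {a b : Fin d} (hab : a ≠ b) => quartic hab 2 1
  push_cast at q1 q2 q3
  have r3 : ∀ {a b}, a ≠ b → H (a, b) (b, b) = H (a, a) (a, b) := by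
    intro a b hab
    linear_combination (1 / 12) * q3 hab - (1 / 4) * q1 hab - (1 / 12) * q2 hab
      + (1 / 2) * hsH a b b b - (1 / 2) * hsH a a a b
  have r4 : ∀ {a b}, a ≠ b → 2 * (H (a, b) (a, b) + H (a, b) (b, a))
      = H (a, a) (a, a) + H (b, b) (b, b) := by
    intro a b hab
    linear_combination -(1 / 2) * q1 hab - (1 / 2) * q2 hab + hsH a b a b + hsH a b b a
  -- The diagonal is halved because `E` acts once on each factor of `e_a ⊗ e_a`.
  let E : Matrix (Fin d) (Fin d) ℂ := Matrix.of fun a c =>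
    if a = c then H (a, a) (a, a) / 2 else H (a, a) (a, c)
  have hEd : ∀ a, E a a = H (a, a) (a, a) / 2 := fun a => by simp [E]
  have hEo : ∀ {a c}, a ≠ c → E a c = H (a, a) (a, c) := fun hac => by simp [E, hac]
  let L : Matrix (Fin d × Fin d) (Fin d × Fin d) ℂ := E ⊗ₖ 1 + 1 ⊗ₖ E
  let R : Fin d → Fin d → Fin d → Fin d → ℂ := fun a b c e =>
    L (a, b) (c, e) + L (a, b) (e, c)
  have hR : ∀ a b c e, R a b c e = E a c * (if b = e then 1 else 0) + (if a = c then 1 else 0) * E b e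
      + (E a e * (if b = c then 1 else 0) + (if a = e then 1 else 0) * E b c) := fun a b c e => by
    simp only [R, L, Matrix.add_apply, kroneckerMap_apply, Matrix.one_apply]
  have hR1 : ∀ a b c e, R a b c e = R a b e c := fun a b c e => add_comm _ _
  have hR2 : ∀ a b c e, R a b c e = R b a c e := fun a b c e => by
    rw [hR, hR]
    ring
  have hshared : ∀ a b e, H (a, b) (a, e) + H (a, b) (e, a) = R a b a e := by
    intro a b e
    rw [hR]
    rcases eq_or_ne a b with rfl | hab
    · rcases eq_or_ne a e with rfl | hae
      · rw [hEd]
        simp only [if_true]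
        ring
      · rw [hEd, hEo hae]
        simp only [if_true, if_neg hae]
        linear_combination -hsH a a a e
    · rcases eq_or_ne a e with rfl | hae
      · rw [hEo hab.symm]
        simp only [if_true, if_neg hab.symm]
        linear_combination 2 * r3 hab.symm + 2 * hsH a b a a
      · rcases eq_or_ne b e with rfl | hbe
        · rw [hEd, hEd]
          simp only [if_true, if_neg hab, if_neg hab.symm]
          linear_combination (1 / 2) * r4 hab
        · rw [hEo hbe]
          simp only [if_true, if_neg hab.symm, if_neg hae, if_neg hbe]
          linear_combination -r2 hab.symm hbe hae + hsH a b e a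
  -- If the two index pairs meet, the symmetries reduce to a common first index; if they are
  -- disjoint, both sides vanish.
  have hkey : ∀ a b c e, H (a, b) (c, e) + H (a, b) (e, c) = R a b c e := by
    intro a b c e
    by_cases hac : a = c
    · subst hac
      exact hshared a b e
    by_cases hae : a = e
    · subst hae
      rw [hR1, ← hshared, add_comm]
    by_cases hbc : b = c
    · subst hbc
      rw [hR2, ← hshared, hsH a b b e, hsH a b e b, add_comm]
    by_cases hbe : b = e
    · subst hbe
      rw [hR2, hR1, ← hshared, hsH a b c b, hsH a b b c]
    rw [r1 hac hae hbc hbe, hR]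
    simp [hac, hae, hbc, hbe]
  refine ⟨E, ?_, fun ψ hψ => ?_⟩
  · ext a c
    rw [conjTranspose_apply]
    rcases eq_or_ne a c with rfl | hac
    · rw [hEd, star_div₀, hH.1.apply]
      simp
    · rw [hEo hac, hEo hac.symm, hH.1.apply, ← r3 hac, hsH]
  · refine mulVec_eq_of_add_swap_eq (s := 1) (fun q => ?_) fun p q => ?_
    · have := congrFun hψ q
      rw [swapMatrix_mulVec] at this
      rw [this, one_mul]
    · obtain ⟨a, b⟩ := p
      obtain ⟨c, e⟩ := q
      simp only [one_mul, Prod.swap_prod_mk]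
      exact hkey a b c e

theorem liftControllable_inducedBos (hd : 2 ≤ d) (hH : IsSymHamiltonian H)
    (hloc : ¬ IsLocalOn (bosonicSpace d) H) :
    LiftControllable (symLocalUnitaries d) (inducedBos H) := by
  refine liftControllable_of_signedPermConj ⟨_, 1, one_mem _, rfl⟩
    (fun U hU => inducedBos_transpose hH.1 hU)
    (fun U hU π ε => exists_inducedBos_eq_signedPermConj hU π ε) fun _ => ?_
  by_contra! hX
  exact hloc (isLocalOn_bosonicSpace hH fun v x hvx =>
    productForm_self_eq_zero_of_inducedBos_eq_zero hd hX hvx)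

end Bosons

/-! ### Fermions -/

section Fermions

variable {d : ℕ} {H : Matrix (Fin d × Fin d) (Fin d × Fin d) ℂ}

theorem star_altForm (hH : IsSymHamiltonian H) (v w x y : Fin d → ℂ) :
    star (altForm H v w x y) = altForm H x y v w := by
  rw [altForm, star_sub, star_productForm _ _ _ _ hH.1, star_productForm _ _ _ _ hH.1,
    hH.productForm_swap y x, altForm]

theorem inducedFer_transpose (hH : IsSymHamiltonian H)
    {U : Matrix (Fin d × Fin d) (Fin d × Fin d) ℂ} (hU : U ∈ symLocalUnitaries d) :
    (inducedFer H U)ᵀ = -inducedFer H U := by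
  obtain ⟨V, -, rfl⟩ := hU
  ext i j
  rw [Matrix.transpose_apply, Matrix.neg_apply, inducedFer_kronecker_apply,
    inducedFer_kronecker_apply, ← star_altForm hH, RCLike.star_def, Complex.conj_im]

theorem injective_sumElim_oddIdx_evenIdx :
    Function.Injective (Sum.elim oddIdx evenIdx : Fin (d / 2) ⊕ Fin (d / 2) → Fin d) := by
  rintro (i | i) (j | j) h <;> simp only [Sum.elim_inl, Sum.elim_inr, oddIdx, evenIdx,
    Fin.mk.injEq] at h
  · exact congrArg Sum.inl (Fin.ext (by omega))
  · omega
  · omega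
  · exact congrArg Sum.inr (Fin.ext (by omega))

/-- Columns are permuted in blocks of two, and the sign is put on the odd column of each block only.
-/
theorem exists_inducedFer_eq_signedPermConj {U : Matrix (Fin d × Fin d) (Fin d × Fin d) ℂ}
    (hU : U ∈ symLocalUnitaries d) (π : Equiv.Perm (Fin (d / 2))) (ε : Fin (d / 2) → ℤˣ) :
    ∃ U' ∈ symLocalUnitaries d, inducedFer H U' = signedPermConj π ε (inducedFer H U) := by
  obtain ⟨V, hV, rfl⟩ := hU
  obtain ⟨V', hV', hVc⟩ := exists_mem_unitaryGroup_col injective_sumElim_oddIdx_evenIdx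
    (orthonormal_smul_comp (orthonormal_col hV injective_sumElim_oddIdx_evenIdx)
      (Equiv.sumCongr π π) (c := Sum.elim (fun k => ((ε k : ℤ) : ℂ)) fun _ => 1) (by
        rintro (k | k)
        · exact units_star_mul ε k
        · simp))
  refine ⟨V' ⊗ₖ V', ⟨V', hV', rfl⟩, ?_⟩
  have ho : ∀ k, V'ᵀ (oddIdx k) = ((ε k : ℤ) : ℂ) • Vᵀ (oddIdx (π k)) := fun k => hVc (Sum.inl k)
  have he : ∀ k, V'ᵀ (evenIdx k) = Vᵀ (evenIdx (π k)) := fun k =>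
    (hVc (Sum.inr k)).trans (one_smul _ _)
  ext i j
  rw [signedPermConj, Matrix.of_apply, inducedFer_kronecker_apply, inducedFer_kronecker_apply,
    ho, ho, he, he, altForm, altForm]
  simp only [productForm_smul_1, productForm_smul_3, productForm_smul_4]
  rcases Int.units_eq_one_or (ε i) with h | h <;> rcases Int.units_eq_one_or (ε j) with h' | h' <;>
    simp [h, h'] <;> ring

theorem productState_zero_left {d₁ d₂ : ℕ} (w : Fin d₂ → ℂ) :
    productState (0 : Fin d₁ → ℂ) w = 0 := by
  ext
  simp [productState]

theorem productState_zero_right {d₁ d₂ : ℕ} (v : Fin d₁ → ℂ) :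
    productState v (0 : Fin d₂ → ℂ) = 0 := by
  ext
  simp [productState]

/-- Two blocks of columns accommodate four mutually orthogonal vectors. The form is linear in `x`,
so the factor `i` handles the real part. -/
theorem altForm_eq_zero_of_inducedFer_eq_zero (hd : 4 ≤ d)
    (hX : ∀ U ∈ symLocalUnitaries d, inducedFer H U = 0) {v w x y : Fin d → ℂ}
    (hvw : star v ⬝ᵥ w = 0) (hvx : star v ⬝ᵥ x = 0) (hvy : star v ⬝ᵥ y = 0)
    (hwx : star w ⬝ᵥ x = 0) (hwy : star w ⬝ᵥ y = 0) (hxy : star x ⬝ᵥ y = 0) :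
    altForm H v w x y = 0 := by
  have him : ∀ {x : Fin d → ℂ}, star v ⬝ᵥ x = 0 → star w ⬝ᵥ x = 0 → star x ⬝ᵥ y = 0 →
      (altForm H v w x y).im = 0 := by
    intro x hvx hwx hxy
    by_cases hv : v = 0
    · simp [hv, altForm, productForm, productState_zero_left]
    by_cases hw : w = 0
    · simp [hw, altForm, productForm, productState_zero_right]
    by_cases hx : x = 0
    · simp [hx, altForm, productForm, productState_zero_left, productState_zero_right]
    by_cases hy : y = 0
    · simp [hy, altForm, productForm, productState_zero_left, productState_zero_right]
    have hsymm : ∀ {u u' : Fin d → ℂ}, star u ⬝ᵥ u' = 0 → star u' ⬝ᵥ u = 0 := by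
      intro u u' h
      rw [star_dotProduct, h, star_zero]
    obtain ⟨V, hV, c, hc, hVc⟩ := exists_mem_unitaryGroup_col_smul
      (e := fun k : Fin 4 => (⟨k.1, by omega⟩ : Fin d)) (v := ![v, w, x, y])
      (fun k l h => Fin.ext (by simpa using h))
      (by intro k; fin_cases k <;> simpa) (by
        intro k l hkl
        fin_cases k <;> fin_cases l <;> first
          | exact absurd rfl hkl
          | assumption
          | exact hsymm ‹_›)
    let i : Fin (d / 2) := ⟨0, by omega⟩
    let j : Fin (d / 2) := ⟨1, by omega⟩
    have h0 : Vᵀ (oddIdx i) = (c 0 : ℂ) • v := hVc 0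
    have h1 : Vᵀ (evenIdx i) = (c 1 : ℂ) • w := hVc 1
    have h2 : Vᵀ (oddIdx j) = (c 2 : ℂ) • x := hVc 2
    have h3 : Vᵀ (evenIdx j) = (c 3 : ℂ) • y := hVc 3
    have h := congrFun₂ (hX _ ⟨V, hV, rfl⟩) i j
    rw [inducedFer_kronecker_apply, h0, h1, h2, h3] at h
    have hlin : altForm H ((c 0 : ℂ) • v) ((c 1 : ℂ) • w) ((c 2 : ℂ) • x) ((c 3 : ℂ) • y)
        = ((c 0 * (c 1 * (c 2 * c 3)) : ℝ) : ℂ) * altForm H v w x y := by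
      simp only [altForm, productForm_smul_1, productForm_smul_2, productForm_smul_3,
        productForm_smul_4, RCLike.star_def, Complex.conj_ofReal]
      push_cast
      ring
    rw [hlin, Complex.im_ofReal_mul, Matrix.zero_apply, neg_eq_zero] at h
    exact (mul_eq_zero.1 h).resolve_left
      (mul_pos (hc 0) (mul_pos (hc 1) (mul_pos (hc 2) (hc 3)))).ne'
  refine Complex.ext ?_ (him hvx hwx hxy)
  have h := him (x := Complex.I • x) (by rw [dotProduct_smul, hvx, smul_zero])
    (by rw [dotProduct_smul, hwx, smul_zero]) (by rw [star_smul, smul_dotProduct, hxy, smul_zero])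
  have hlin : altForm H v w (Complex.I • x) y = Complex.I * altForm H v w x y := by
    simp only [altForm, productForm_smul_3, productForm_smul_4]
    ring
  rwa [hlin, Complex.I_mul_im] at h

theorem exists_notMem_of_card_lt {s : Finset (Fin d)} (h : s.card < d) : ∃ a, a ∉ s := by
  by_contra! hs
  have : s = Finset.univ := Finset.eq_univ_iff_forall.2 hs
  rw [this, Finset.card_univ, Fintype.card_fin] at h
  exact lt_irrefl _ h

theorem exists_ne_ne (hd : 4 ≤ d) (a b c : Fin d) : ∃ e, a ≠ e ∧ b ≠ e ∧ c ≠ e := by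
  obtain ⟨e, he⟩ := exists_notMem_of_card_lt (s := {a, b, c})
    ((Finset.card_le_three).trans_lt (by omega))
  simp only [Finset.mem_insert, Finset.mem_singleton, not_or] at he
  exact ⟨e, Ne.symm he.1, Ne.symm he.2.1, Ne.symm he.2.2⟩

/-- A symmetric function of pairs which satisfies the four-point condition is of the form
`(a, b) ↦ g a + g b` off the diagonal. -/
theorem exists_eq_add_of_four_point (hd : 4 ≤ d) {D : Fin d → Fin d → ℂ}
    (hsymm : ∀ a b, D a b = D b a)
    (h : ∀ {a b c e}, a ≠ b → a ≠ c → a ≠ e → b ≠ c → b ≠ e → c ≠ e →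
      D a c - D a e - D b c + D b e = 0) :
    ∃ g : Fin d → ℂ, ∀ a p q, a ≠ p → a ≠ q → p ≠ q → D a p + D a q - D p q = 2 * g a := by
  have key : ∀ a, ∃ z, ∀ p q, a ≠ p → a ≠ q → p ≠ q → D a p + D a q - D p q = 2 * z := by
    intro a
    have step : ∀ {p q r}, a ≠ p → a ≠ q → a ≠ r → p ≠ q → p ≠ r →
        D a p + D a q - D p q = D a p + D a r - D p r := by
      intro p q r hap haq har hpq hpr
      rcases eq_or_ne q r with rfl | hqr
      · rfl
      linear_combination h hap haq har hpq hpr hqr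
    have flip : ∀ p q, D a p + D a q - D p q = D a q + D a p - D q p := by
      intro p q
      rw [hsymm p q]
      ring
    obtain ⟨p₀, hp₀, -, -⟩ := exists_ne_ne hd a a a
    obtain ⟨q₀, hq₀, hpq₀, -⟩ := exists_ne_ne hd a p₀ p₀
    refine ⟨(D a p₀ + D a q₀ - D p₀ q₀) / 2, fun p q hap haq hpq => ?_⟩
    -- The pair `(p, q)` is changed one index at a time: `(p, q)`, `(p, s)`, `(p₀, s)`, `(p₀, q₀)`.
    -- The auxiliary `s` keeps the two indices of each pair distinct.
    obtain ⟨s, has, hps, hp₀s⟩ := exists_ne_ne hd a p p₀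
    rw [step hap haq has hpq hps, flip, step has hap hp₀ hps.symm hp₀s.symm, flip,
      step hp₀ has hq₀ hp₀s hpq₀]
    ring
  choose g hg using key
  exact ⟨g, hg⟩

/-- Only the antisymmetrized entries `A` matter. Orthogonal quadruples of basis vectors, sums and
differences show that `A` vanishes on disjoint pairs, that `A a b a c` does not depend on `a`, and
that `A a b a b` satisfies the four-point condition. The latter two supply the off-diagonal and
diagonal entries of `E`. -/
theorem isLocalOn_fermionicSpace (hd : 4 ≤ d) (hH : IsSymHamiltonian H)
    (h : ∀ v w x y, star v ⬝ᵥ w = 0 → star v ⬝ᵥ x = 0 → star v ⬝ᵥ y = 0 → star w ⬝ᵥ x = 0 →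
      star w ⬝ᵥ y = 0 → star x ⬝ᵥ y = 0 → altForm H v w x y = 0) :
    IsLocalOn (fermionicSpace d) H := by
  have hsH : ∀ a b c e, H (a, b) (c, e) = H (b, a) (e, c) := fun a b c e =>
    hH.apply_swap (b, a) (e, c)
  obtain ⟨A, hA⟩ : ∃ A : Fin d → Fin d → Fin d → Fin d → ℂ,
      ∀ a b c e, A a b c e = H (a, b) (c, e) - H (a, b) (e, c) := ⟨_, fun _ _ _ _ => rfl⟩
  have hA1 : ∀ a b c e, A a b e c = -A a b c e := fun a b c e => by
    rw [hA, hA]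
    ring
  have hA2 : ∀ a b c e, A b a c e = -A a b c e := fun a b c e => by
    rw [hA, hA, hsH b a c e, hsH b a e c]
    ring
  have hA3 : ∀ a b c e, star (A a b c e) = A c e a b := fun a b c e => by
    rw [hA, hA, star_sub, hH.1.apply, hH.1.apply, hsH e c]
  have hform : ∀ a b c e,
      productForm H (Pi.single a 1) (Pi.single b 1) (Pi.single c 1) (Pi.single e 1)
        - productForm H (Pi.single a 1) (Pi.single b 1) (Pi.single e 1) (Pi.single c 1)
        = A a b c e := fun a b c e => by
    rw [productForm_single, productForm_single, hA]
  have o := fun {a b : Fin d} (hab : a ≠ b) => star_single_dotProduct_single hab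
  have o' := fun {a b : Fin d} (hab : a ≠ b) => star_single_add_dotProduct_single_sub hab
  have hdiag1 : ∀ a c e, A a a c e = 0 := fun a c e => by
    linear_combination (1 / 2) * hA2 a a c e
  have hdiag2 : ∀ a b c, A a b c c = 0 := fun a b c => by
    linear_combination (1 / 2) * hA1 a b c c
  have r1 : ∀ {a b c e}, a ≠ c → a ≠ e → b ≠ c → b ≠ e → A a b c e = 0 := by
    intro a b c e hac hae hbc hbe
    rcases eq_or_ne a b with rfl | hab
    · exact hdiag1 _ _ _
    rcases eq_or_ne c e with rfl | hce
    · exact hdiag2 _ _ _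
    rw [← hform]
    exact h _ _ _ _ (o hab) (o hac) (o hae) (o hbc) (o hbe) (o hce)
  have r2 : ∀ {a a' b c}, a ≠ b → a ≠ c → a' ≠ b → a' ≠ c → b ≠ c →
      A a b a c = A a' b a' c := by
    intro a a' b c hab hac hab' hac' hbc
    rcases eq_or_ne a a' with rfl | haa
    · rfl
    have h1 := h (Pi.single a 1 + Pi.single a' 1) (Pi.single b 1)
      (Pi.single a 1 - Pi.single a' 1) (Pi.single c 1) (by simp [hab, hab']) (o' haa)
      (by simp [hac, hac']) (by simp [hab.symm, hab'.symm]) (o hbc) (by simp [hac, hac'])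
    simp only [altForm, productForm_add_1, productForm_sub_3, productForm_sub_4,
      productForm_single] at h1
    have e1 := r1 haa hac hab'.symm hbc
    have e2 := r1 haa.symm hac' hab.symm hbc
    rw [hA] at e1 e2 ⊢
    rw [hA]
    linear_combination h1 + e1 - e2
  have r4 : ∀ {a b c e}, a ≠ b → a ≠ c → a ≠ e → b ≠ c → b ≠ e → c ≠ e →
      A a c a c - A a e a e - A b c b c + A b e b e = 0 := by
    intro a b c e hab hac hae hbc hbe hce
    have h1 := h (Pi.single a 1 + Pi.single b 1) (Pi.single c 1 + Pi.single e 1)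
      (Pi.single a 1 - Pi.single b 1) (Pi.single c 1 - Pi.single e 1)
      (by simp [hac, hae, hbc, hbe]) (o' hab) (by simp [hac, hae, hbc, hbe])
      (by simp [hac.symm, hae.symm, hbc.symm, hbe.symm]) (o' hce) (by simp [hac, hae, hbc, hbe])
    have h2 : A a c a c - A a c a e - A a c b c + A a c b e + (A a e a c - A a e a e - A a e b c
        + A a e b e) + (A b c a c - A b c a e - A b c b c + A b c b e) + (A b e a c - A b e a e
        - A b e b c + A b e b e) = 0 := by
      simp only [altForm, productForm_add_1, productForm_add_2, productForm_sub_3,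
        productForm_sub_4, productForm_single] at h1
      simp only [hA]
      linear_combination h1
    have f1 := r2 hac hae hbc hbe hce
    have f2 := r2 hae hac hbe hbc hce.symm
    have f3 := r2 hac.symm hbc.symm hae.symm hbe.symm hab
    have f4 := r2 hbc.symm hac.symm hbe.symm hae.symm hab.symm
    have g1 : ∀ p q r, A p q r q = A q p q r := fun p q r => by rw [hA2, hA1, neg_neg]
    rw [← g1 a c b, ← g1 a e b] at f3
    rw [← g1 b c a, ← g1 b e a] at f4
    linear_combination h2 + f1 - f2 + f3 - f4 - r1 hab hae hbc.symm hce
      + r1 hab hac hbe.symm hce.symm + r1 hab.symm hbe hac.symm hce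
      - r1 hab.symm hbc hae.symm hce.symm
  -- The condition `b ≠ c` sits inside the existential so that `choose` yields a function of `b` and
  -- `c` alone; its diagonal values are not used.
  have hoff : ∀ b c, ∃ z, b ≠ c → ∀ a, a ≠ b → a ≠ c → A a b a c = z := by
    intro b c
    obtain ⟨a, hab, hac, -⟩ := exists_ne_ne hd b c c
    exact ⟨A a b a c, fun hbc a' hab' hac' => r2 hab' hac' hab.symm hac.symm hbc⟩
  choose F hF using hoff
  obtain ⟨G, hG⟩ := exists_eq_add_of_four_point hd (D := fun a b => A a b a b)
    (fun a b => by rw [hA2, hA1, neg_neg]) r4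
  let E : Matrix (Fin d) (Fin d) ℂ := Matrix.of fun a c => if a = c then G a else F a c
  have hEd : ∀ a, E a a = G a := fun a => by simp [E]
  have hEo : ∀ {a c}, a ≠ c → E a c = F a c := fun hac => by simp [E, hac]
  let L : Matrix (Fin d × Fin d) (Fin d × Fin d) ℂ := E ⊗ₖ 1 + 1 ⊗ₖ E
  let R : Fin d → Fin d → Fin d → Fin d → ℂ := fun a b c e =>
    L (a, b) (c, e) + -1 * L (a, b) (e, c)
  have hR : ∀ a b c e, R a b c e =
      E a c * (if b = e then 1 else 0) + (if a = c then 1 else 0) * E b e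
      + -1 * (E a e * (if b = c then 1 else 0) + (if a = e then 1 else 0) * E b c) :=
    fun a b c e => by
      simp only [R, L, Matrix.add_apply, kroneckerMap_apply, Matrix.one_apply]
  have hR1 : ∀ a b c e, R a b e c = -R a b c e := fun a b c e => by
    rw [hR, hR]
    ring
  have hR2 : ∀ a b c e, R b a c e = -R a b c e := fun a b c e => by
    rw [hR, hR]
    ring
  have hshared : ∀ a b e, A a b a e = R a b a e := by
    intro a b e
    rcases eq_or_ne a b with rfl | hab
    · rw [hdiag1]
      linear_combination -(1 / 2) * hR2 a a a e
    rcases eq_or_ne a e with rfl | hae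
    · rw [hdiag2]
      linear_combination -(1 / 2) * hR1 a b a a
    rw [hR]
    rcases eq_or_ne b e with rfl | hbe
    · rw [hEd, hEd]
      simp only [if_true, if_neg hab, if_neg hab.symm]
      obtain ⟨q, haq, hbq, -⟩ := exists_ne_ne hd a b b
      have e1 := hG a b q hab haq hbq
      have e2 := hG b a q hab.symm hbq haq
      have e3 : A b a b a = A a b a b := by rw [hA2, hA1, neg_neg]
      -- Adding the identities for `2 G a` and `2 G b` cancels the auxiliary `q` and gives `A a b a
      -- b = G a + G b`.
      linear_combination (1 / 2) * e1 + (1 / 2) * e2 - (1 / 2) * e3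
    · rw [hEo hbe]
      simp only [if_true, if_neg hab.symm, if_neg hae, if_neg hbe]
      linear_combination hF b e hbe a hab hae
  have hkey : ∀ a b c e, A a b c e = R a b c e := by
    intro a b c e
    by_cases hac : a = c
    · subst hac
      exact hshared a b e
    by_cases hae : a = e
    · subst hae
      rw [hA1, hR1, hshared]
    by_cases hbc : b = c
    · subst hbc
      rw [hA2, hR2, hshared]
    by_cases hbe : b = e
    · subst hbe
      rw [hA2, hR2, hA1, hR1, hshared]
    rw [r1 hac hae hbc hbe, hR]
    simp [hac, hae, hbc, hbe]
  refine ⟨E, ?_, fun ψ hψ => ?_⟩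
  · ext a c
    rw [conjTranspose_apply]
    rcases eq_or_ne a c with rfl | hac
    · rw [hEd]
      obtain ⟨p, hap, -, -⟩ := exists_ne_ne hd a a a
      obtain ⟨q, haq, hpq, -⟩ := exists_ne_ne hd a p p
      have e1 := hG a p q hap haq hpq
      have e2 := congrArg star e1
      rw [star_sub, star_add, hA3, hA3, hA3, e1, star_mul'] at e2
      simp only [star_ofNat] at e2
      exact (mul_left_cancel₀ (two_ne_zero' ℂ) e2).symm
    · obtain ⟨b, hab, hcb, -⟩ := exists_ne_ne hd a c c
      rw [hEo hac, hEo hac.symm, ← hF a c hac b hab.symm hcb.symm,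
        ← hF c a hac.symm b hcb.symm hab.symm, hA3]
  · refine mulVec_eq_of_add_swap_eq (s := -1) (fun q => ?_) fun p q => ?_
    · have := congrFun hψ q
      rw [swapMatrix_mulVec] at this
      rw [this, neg_one_mul, Pi.neg_apply]
    · obtain ⟨a, b⟩ := p
      obtain ⟨c, e⟩ := q
      simp only [Prod.swap_prod_mk]
      rw [neg_one_mul, ← sub_eq_add_neg, ← hA]
      exact hkey a b c e

theorem liftControllable_inducedFer (hH : IsSymHamiltonian H)
    (hloc : ¬ IsLocalOn (fermionicSpace d) H) :
    LiftControllable (symLocalUnitaries d) (inducedFer H) := by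
  refine liftControllable_of_signedPermConj ⟨_, 1, one_mem _, rfl⟩
    (fun U hU => inducedFer_transpose hH hU)
    (fun U hU π ε => exists_inducedFer_eq_signedPermConj hU π ε) fun hn => ?_
  by_contra! hX
  -- From `2 ≤ d / 2` follows `4 ≤ d`, so four orthogonal columns are available.
  exact hloc (isLocalOn_fermionicSpace (by omega) hH
    fun v w x y hvw hvx hvy hwx hwy hxy =>
      altForm_eq_zero_of_inducedFer_eq_zero (by omega) hX hvw hvx hvy hwx hwy hxy)

end Fermions

end Bipartite

theorem proposition3p2 :
    -- distinguishable subsystems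
    (∀ d₁ d₂ : ℕ, 2 ≤ d₁ → 2 ≤ d₂ →
      (Bipartite.weylRep (min d₁ d₂)).IsIrreducible ∧
      ∀ H₀ : Matrix (Fin d₁ × Fin d₂) (Fin d₁ × Fin d₂) ℂ,
        H₀.IsHermitian → ¬ Bipartite.IsLocal H₀ →
        Bipartite.LiftControllable (Bipartite.localUnitaries d₁ d₂)
          (Bipartite.inducedDist H₀)) ∧
    -- bosons
    (∀ d : ℕ, 2 ≤ d →
      (Bipartite.weylRep d).IsIrreducible ∧
      ∀ H₀ : Matrix (Fin d × Fin d) (Fin d × Fin d) ℂ,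
        Bipartite.IsSymHamiltonian H₀ →
        ¬ Bipartite.IsLocalOn (Bipartite.bosonicSpace d) H₀ →
        Bipartite.LiftControllable (Bipartite.symLocalUnitaries d)
          (Bipartite.inducedBos H₀)) ∧
    -- fermions
    (∀ d : ℕ, 2 ≤ d →
      (4 ≤ d → (Bipartite.weylRep (d / 2)).IsIrreducible) ∧
      ∀ H₀ : Matrix (Fin d × Fin d) (Fin d × Fin d) ℂ,
        Bipartite.IsSymHamiltonian H₀ →
        ¬ Bipartite.IsLocalOn (Bipartite.fermionicSpace d) H₀ →
        Bipartite.LiftControllable (Bipartite.symLocalUnitaries d)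
          (Bipartite.inducedFer H₀)) := by
  refine ⟨fun d₁ d₂ h₁ h₂ => ⟨Bipartite.weylRep_isIrreducible (le_min h₁ h₂), fun H₀ hH hloc =>
    Bipartite.liftControllable_inducedDist h₁ h₂ hH hloc⟩,
    fun d hd => ⟨Bipartite.weylRep_isIrreducible hd, fun H₀ hH hloc =>
      Bipartite.liftControllable_inducedBos hd hH hloc⟩,
    fun d _ => ⟨fun hd => Bipartite.weylRep_isIrreducible (by omega), fun H₀ hH hloc =>
      Bipartite.liftControllable_inducedFer hH hloc⟩⟩
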